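/- **Setting.** Let $\mathcal S,\mathcal A$ be finite sets, $P(\cdot\mid s,a)$ a transition kernel in which every state-action pair has at most two possible successor states (a binarized MDP), $\nu_0$ an initial distribution and $\gamma\in[0,1)$ a discount factor. For a stationary policy $\pi$ let $d^\pi(s,a)=(1-\gamma)\sum_{h\ge 0}\gamma^h\,\mathbb P[s_h=s,a_h=a]$, where $s_0\sim\nu_0$ and actions are drawn from $\pi$. Fix $K\ge 1$, $\delta\in(0,1)$ and $L=\lceil 36\log(|\mathcal S||\mathcal A|K/\delta)\rceil$. **Algorithm (Tabular SOAR-IL).** Inputs: $\eta\ge0$, $\alpha\in\mathbb R$, a finite expert dataset (of states, or of state-action pairs), an initial cost $c^0\in[0,1]^{\mathcal S\times\mathcal A}$, an initial value estimate $V^1\in[0,(1-\gamma)^{-1}]^{\mathcal S}$, and one of the two aggregation rules below. The policy $\pi^1$ is uniform over actions, all counts are zero, and all datasets $\mathcal R_\ell$ ($\ell\in\mathbb Z/L$) are empty. For $k=1,\dots,K$: 1. Sample a length $L^k\ge1$ with $\mathbb P[L^k=n]=(1-\gamma)\gamma^{n-1}$ and roll out $\pi^k$ from $s_1^k\sim\nu_0$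 for $L^k$ steps. For each visited $(s_t^k,a_t^k)$, in order, increase the visit count $N(s_t^k,a_t^k)$ by one and add $(s_t^k,a_t^k,s_{t+1}^k)$, with multiplicity, to $\mathcal R_\ell$ with $\ell=N(s_t^k,a_t^k)\bmod L$. 2. Set $c^k=\Pi\bigl[c^{k-1}-\alpha(\widehat d_E-\widehat d^k)\bigr]$, where $\Pi$ is the projection onto $[0,1]^{\mathcal S\times\mathcal A}$, $\widehat d_E$ is the empirical frequency vector of the expert dataset, and $\widehat d^k$ is the indicator of the last visited state-action pair $(s^k_{L^k},a^k_{L^k})$; for a state-only dataset, frequencies of states and the indicator of the last visited state $s^k_{L^k}$ are used instead, as functions of $(s,a)$ that do not depend on $a$. 3. Let $\widehat P^k_\ell(s'\mid s,a)=N^k_\ell(s,a,s')/(N^k_\ell(s,a)+2)$ with the counts of $\mathcal R_\ell$, and $x_\ell(s,a)=\sum_{s'}\widehat P^k_\ell(s'\mid s,a)V^k(s')$. Set $Q^{k+1}=c^k+\gamma\min_\ell x_\ell$ (Min), or $Q^{k+1}=c^k+\gamma\max\{\bar x-\sigma,0\}$ with $\bar x=\frac1L\sum_\ell x_\ell$ and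 $\sigma=\sqrt{\sum_\ell(x_\ell-\bar x)^2}$ (Mean-Std). 4. Set $\pi^{k+1}(a\mid s)\propto\pi^k(a\mid s)e^{-\eta Q^{k+1}(s,a)}$ and $V^{k+1}(s)=\sum_a\pi^{k+1}(a\mid s)Q^{k+1}(s,a)$. The policy regret against a stationary policy $\pi^\star$ is $\mathrm{Regret}_\pi(K,\pi^\star)=\frac1{1-\gamma}\sum_{k=1}^K\langle c^k,d^{\pi^k}-d^{\pi^\star}\rangle$. **Theorem (Policy Regret).** In the following, $\widetilde{\mathcal O}(x)$ stands for $C\bigl(1+\log\frac{|\mathcal S||\mathcal A|K}{(1-\gamma)\delta}\bigr)^p x$ with universal constants $C>0$ and $p\in\mathbb N$. Under either aggregation rule, the following hold. (i) For every $\eta>0$, with probability at least $1-3\delta$, simultaneously for all stationary policies $\pi^\star$, $$\mathrm{Regret}_\pi(K,\pi^\star)\le\frac{\log|\mathcal A|}{\eta(1-\gamma)}+\frac{\eta K}{(1-\gamma)^4}+\widetilde{\mathcal O}\!\left(\frac{\sqrt{K|\mathcal S|^2|\mathcal A|\log(1/\delta)}}{(1-\gamma)^2}\right).$$ (ii) For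 $\eta=\sqrt{\log|\mathcal A|\,(1-\gamma)^3/K}$, with probability at least $1-3\delta$, simultaneously for all stationary policies $\pi^\star$, $$\mathrm{Regret}_\pi(K,\pi^\star)\le\widetilde{\mathcal O}\!\left(\sqrt{\frac{K|\mathcal S|^2|\mathcal A|\log(1/\delta)}{(1-\gamma)^5}}\right).$$ -/

import Mathlib

universe u v

namespace Soar

/-- The transition part of a discounted Markov decision process with state space `S` and action
space `A`: transition kernel, initial distribution and discount factor in `[0, 1)`. Cost functions
`S → A → ℝ` are kept apart, because the cost changes from one iteration to the next. -/
structure MDP (S : Type u) (A : Type v) where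
  P : S → A → PMF S
  ν₀ : PMF S
  γ : ℝ
  γ_nonneg : 0 ≤ γ
  γ_lt_one : γ < 1

/-- Stationary randomized policies. -/
abbrev Policy (S : Type u) (A : Type v) := S → PMF A

namespace MDP

/-- Every state-action pair has at most two possible successor states. -/
def IsBinarized {S : Type u} {A : Type v} (M : MDP S A) : Prop :=
  ∀ s a, (M.P s a).support.encard ≤ 2

/-- Law of the state reached after `h` steps of acting with `π` from `s ∼ ν₀`. -/
noncomputable def stateLaw {S : Type u} {A : Type v} (M : MDP S A) (π : Policy S A) : ℕ → PMF S
  | 0 => M.ν₀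
  | h + 1 => (M.stateLaw π h).bind fun s => (π s).bind fun a => M.P s a

/-- Normalized discounted state-action occupancy measure
`d^π(s,a) = (1 - γ) ∑ₕ γ^h ℙ[s_h = s, a_h = a]`. -/
noncomputable def occupancy {S : Type u} {A : Type v} (M : MDP S A) (π : Policy S A)
    (s : S) (a : A) : ℝ :=
  (1 - M.γ) * ∑' h : ℕ, M.γ ^ h * ((M.stateLaw π h s).toReal * (π s a).toReal)

/-- Sample `n` consecutive transitions `(s_t, a_t, s_{t+1})` with `π`, starting in state `s`. -/
noncomputable def rollout {S : Type u} {A : Type v} (M : MDP S A) (π : Policy S A) :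
    ℕ → S → PMF (List (S × A × S))
  | 0, _ => PMF.pure []
  | n + 1, s =>
      (π s).bind fun a => (M.P s a).bind fun s' =>
        (M.rollout π n s').map fun τ => (s, a, s') :: τ

/-- The trajectory length: `ℙ[length = n] = (1 - γ) γ^(n - 1)` for `n ≥ 1`. Mathlib's geometric
distribution counts the failures before the first success, hence the shift by one. -/
noncomputable def lengthLaw {S : Type u} {A : Type v} (M : MDP S A) : PMF ℕ :=
  (ProbabilityTheory.geometricMeasure
    ⟨1 - M.γ, sub_nonneg.2 M.γ_lt_one.le, sub_le_self 1 M.γ_nonneg⟩).toPMF.map (· + 1)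

/-- Law of a trajectory: sample the length, the initial state, and roll out `π`. -/
noncomputable def trajectoryLaw {S : Type u} {A : Type v} (M : MDP S A) (π : Policy S A) :
    PMF (List (S × A × S)) :=
  M.lengthLaw.bind fun n => M.ν₀.bind fun s => M.rollout π n s

end MDP

/-- An expert dataset, consisting either of states only or of state-action pairs. -/
inductive ExpertData (S : Type u) (A : Type v) where
  | stateOnly (D : List S)
  | stateAction (D : List (S × A))

/-- The rule that aggregates the ensemble: `min` of the estimators, or mean minus standard
deviation. -/
inductive Rule where
  | min
  | meanStd

/-- The inputs of the algorithm: step sizes `η` (policy) and `α` (cost), number `L` of critics,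
aggregation rule, expert data, initial cost `c⁰` and initial state value estimate `V¹`. -/
structure Input (S : Type u) (A : Type v) where
  η : ℝ
  α : ℝ
  L : ℕ
  rule : Rule
  expert : ExpertData S A
  c₀ : S → A → ℝ
  V₁ : S → ℝ

/-- The memory of the algorithm between two iterations. The visits are stored in the datasets
`R ℓ`, `ℓ < L`, with multiplicity. -/
structure State (S : Type u) (A : Type v) where
  policy : Policy S A
  V : S → ℝ
  c : S → A → ℝ
  N : S → A → ℕ
  R : ℕ → Multiset (S × A × S)

/-- Initial memory; the first policy is uniform. -/
noncomputable def initState {S : Type u} {A : Type v} [Fintype A] [Nonempty A] (I : Input S A) :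
    State S A where
  policy := fun _ => PMF.uniformOfFintype A
  V := I.V₁
  c := I.c₀
  N := fun _ _ => 0
  R := fun _ => 0

/-- Process one transition: increase the visit count of `(s, a)` and put the transition into the
dataset with index `N(s, a) mod L`. -/
def record {S : Type u} {A : Type v} [DecidableEq S] [DecidableEq A] (L : ℕ)
    (m : (S → A → ℕ) × (ℕ → Multiset (S × A × S))) (x : S × A × S) :
    (S → A → ℕ) × (ℕ → Multiset (S × A × S)) :=
  (fun s a => if s = x.1 ∧ a = x.2.1 then m.1 s a + 1 else m.1 s a,
   fun ℓ => if ℓ = (m.1 x.1 x.2.1 + 1) % L then x ::ₘ m.2 ℓ else m.2 ℓ)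

/-- Estimate of the learner's occupancy measure: the indicator of the last visited state (lifted to
state-action pairs), or of the last visited state-action pair. -/
noncomputable def learnerEstimate {S : Type u} {A : Type v} [DecidableEq S] [DecidableEq A]
    (D : ExpertData S A) (τ : List (S × A × S)) (s : S) (a : A) : ℝ :=
  match D with
  | .stateOnly _ => if τ.getLast?.map (fun x => x.1) = some s then 1 else 0
  | .stateAction _ => if τ.getLast?.map (fun x => (x.1, x.2.1)) = some (s, a) then 1 else 0

/-- Empirical estimate of the expert's occupancy measure. -/
noncomputable def expertEstimate {S : Type u} {A : Type v} [DecidableEq S] [DecidableEq A]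
    (D : ExpertData S A) (s : S) (a : A) : ℝ :=
  match D with
  | .stateOnly D => (D.length : ℝ)⁻¹ * D.count s
  | .stateAction D => (D.length : ℝ)⁻¹ * D.count (s, a)

/-- One projected gradient step on the cost. The set of costs is the cube `[0,1]^(S × A)`, so the
Euclidean projection clips every coordinate. -/
noncomputable def costUpdate {S : Type u} {A : Type v} [DecidableEq S] [DecidableEq A]
    (D : ExpertData S A) (α : ℝ) (c : S → A → ℝ) (τ : List (S × A × S)) (s : S) (a : A) : ℝ :=
  max 0 (min 1 (c s a - α * (expertEstimate D s a - learnerEstimate D τ s a)))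

/-- Estimated transitions from one dataset: `N_ℓ(s,a,s') / (N_ℓ(s,a) + 2)`. -/
noncomputable def estP {S : Type u} {A : Type v} [DecidableEq S] [DecidableEq A]
    (R : Multiset (S × A × S)) (s : S) (a : A) (s' : S) : ℝ :=
  (R.count (s, a, s') : ℝ) /
    ((R.countP fun x => x.1 = s ∧ x.2.1 = a : ℕ) + 2)

/-- The estimate `(P̂_ℓ V)(s, a)` of the critic with dataset `R`. -/
noncomputable def critic {S : Type u} {A : Type v} [Fintype S] [DecidableEq S] [DecidableEq A]
    (R : Multiset (S × A × S)) (V : S → ℝ) (s : S) (a : A) : ℝ :=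
  ∑ s', estP R s a s' * V s'

/-- Aggregation of `L` numbers: their minimum, or
`max (mean - √(∑ (xℓ - mean)²)) 0`. -/
noncomputable def aggregate {L : ℕ} (rule : Rule) (x : Fin L → ℝ) : ℝ :=
  match rule with
  | .min => ⨅ ℓ, x ℓ
  | .meanStd =>
      max ((∑ ℓ, x ℓ) / L - Real.sqrt (∑ ℓ, (x ℓ - (∑ ℓ', x ℓ') / L) ^ 2)) 0

/-- The optimistic state-action value estimate. -/
noncomputable def optimisticQ {S : Type u} {A : Type v} [Fintype S] [DecidableEq S] [DecidableEq A]
    (γ : ℝ) (L : ℕ) (rule : Rule) (R : ℕ → Multiset (S × A × S)) (V : S → ℝ) (c : S → A → ℝ)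
    (s : S) (a : A) : ℝ :=
  c s a + γ * aggregate rule (fun ℓ : Fin L => critic (R ℓ) V s a)

/-- Multiplicative weights: the distribution proportional to `p(a) exp(-η q(a))`. -/
noncomputable def mwUpdate {A : Type v} [Fintype A] (η : ℝ) (p : PMF A) (q : A → ℝ) : PMF A :=
  PMF.normalize (fun a => p a * ENNReal.ofReal (Real.exp (-η * q a)))
    (by
      obtain ⟨a, ha⟩ := p.support_nonempty
      rw [Ne, ENNReal.tsum_eq_zero]
      intro h
      have h1 := h a
      rw [mul_eq_zero, ENNReal.ofReal_eq_zero] at h1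
      rcases h1 with h1 | h1
      · exact (p.mem_support_iff a).1 ha h1
      · exact absurd h1 (not_le.2 (Real.exp_pos _)))
    (by
      rw [tsum_fintype]
      exact ENNReal.sum_ne_top.2 fun a _ =>
        ENNReal.mul_ne_top (p.apply_ne_top a) ENNReal.ofReal_ne_top)

/-- One iteration: from the memory before iteration `k` and the trajectory `τᵏ` sampled in it,
update counts and datasets, the cost `cᵏ`, then `Qᵏ⁺¹`, `πᵏ⁺¹` and `Vᵏ⁺¹`. -/
noncomputable def step {S : Type u} {A : Type v} [Fintype S] [DecidableEq S]
    [Fintype A] [DecidableEq A] (γ : ℝ) (I : Input S A) (σ : State S A)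
    (τ : List (S × A × S)) : State S A :=
  let m := τ.foldl (record I.L) (σ.N, σ.R)
  let c := costUpdate I.expert I.α σ.c τ
  let Q := optimisticQ γ I.L I.rule m.2 σ.V c
  let π : Policy S A := fun s => mwUpdate I.η (σ.policy s) (Q s)
  { policy := π
    V := fun s => ∑ a, (π s a).toReal * Q s a
    c := c
    N := m.1
    R := m.2 }

/-- The memory after the iterations with trajectories `τs = [τ¹, …, τᵏ]`. -/
noncomputable def run {S : Type u} {A : Type v} [Fintype S] [DecidableEq S]
    [Fintype A] [Nonempty A] [DecidableEq A] (γ : ℝ) (I : Input S A)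
    (τs : List (List (S × A × S))) : State S A :=
  τs.foldl (step γ I) (initState I)

/-- Law of the list `[τ¹, …, τᴷ]` of trajectories when the algorithm runs for `K` iterations:
trajectory `k + 1` is sampled with the policy computed from the first `k` trajectories. -/
noncomputable def law {S : Type u} {A : Type v} [Fintype S] [DecidableEq S]
    [Fintype A] [Nonempty A] [DecidableEq A] (M : MDP S A) (I : Input S A) :
    ℕ → PMF (List (List (S × A × S)))
  | 0 => PMF.pure []
  | k + 1 => (law M I k).bind fun τs =>
      (M.trajectoryLaw (run M.γ I τs).policy).map fun τ => τs ++ [τ]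

/-- Policy regret `(1 - γ)⁻¹ ∑ₖ ⟨cᵏ, d^{πᵏ} - d^{π⋆}⟩` over `K` iterations, as a function of the
trajectories. With `k` counted from zero, the policy played in iteration `k` is known before that
iteration, and the cost is computed in it. -/
noncomputable def policyRegret {S : Type u} {A : Type v} [Fintype S] [DecidableEq S]
    [Fintype A] [Nonempty A] [DecidableEq A] (M : MDP S A) (I : Input S A) (K : ℕ)
    (πstar : Policy S A) (τs : List (List (S × A × S))) : ℝ :=
  (1 - M.γ)⁻¹ * ∑ k ∈ Finset.range K, ∑ s, ∑ a,
    (run M.γ I (τs.take (k + 1))).c s a *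
      (M.occupancy (run M.γ I (τs.take k)).policy s a - M.occupancy πstar s a)

/-- Number of critics: `36 log(|S||A|K/δ)`, rounded up. -/
noncomputable def numCritics (S : Type u) (A : Type v) [Fintype S] [Fintype A] (K : ℕ) (δ : ℝ) :
    ℕ :=
  ⌈36 * Real.log (Fintype.card S * Fintype.card A * K / δ)⌉₊

/-- The quantity whose powers are hidden in `Õ`. -/
noncomputable def logFactor (S : Type u) (A : Type v) [Fintype S] [Fintype A] (K : ℕ) (γ δ : ℝ) :
    ℝ :=
  1 + Real.log (Fintype.card S * Fintype.card A * K / ((1 - γ) * δ))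

end Soar

/-! Write B = 1/(1-γ). Applied to the current value estimate V, the flow constraint
`MDP.occupancy_flow` expresses the cost of any policy as an initial term common to all policies,
plus its expected Bellman gap c + γPV - Q, plus its expected advantage ⟨π, Q⟩ - V. If Q is
optimistic, the comparator's gap is nonnegative and can be dropped. The advantages telescope over
the iterations, up to the multiplicative-weights term of `be_the_leader` and the drift of policies
and occupancies between consecutive iterations. Stability of the update (`sum_sub_mwUpdate_mul_le`)
makes this drift at most ηB³ per iteration. The result is `MDP.optimistic_regret`; what is left to
control is the gap under the learner's own occupancy.

Optimism rests on binarization. Let y be the successor of larger value, p its probability and n the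
size of a dataset. The critic is at most PV as soon as y was counted at most p(n+2) times. The value
vector depends on the data, but it enters only through the choice of y, so a union bound over y
replaces a covering of value functions. Each count is small enough with probability at least 1/12
(`binE_optimism_le`), and the datasets are disjoint, so all L critics fail with probability at most
(11/12)^L. No independent samples are constructed: `visitPotential`, a product of conditional
binomial expectations, does not increase in mean along the transitions, whatever policies are
played. Both aggregation rules stay below every critic and lose at most 3L times the largest critic
error.

The gap at a pair is of order (number of visits)^(-1/2). Counting only the trajectories that end at
the pair weakens this bound, but the last pair of a trajectory has exactly the law `MDP.occupancy`
(`MDP.expect_trajectoryLaw_lastPair`). The exponential supermartingale of `widthLog` therefore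
trades widths averaged over occupancies for widths at the sampled pairs, whose sum is at most
2√(|S||A|K).

Since L does not involve 1/(1-γ), the union bound over visit counts must not either. If √K ≤ B the
claim follows from costs lying in [0,1]; otherwise Markov's inequality caps the total number of
transitions at K²/δ. -/

namespace Soar
open scoped ENNReal

/-! ### Expectations of nonnegative functions -/

section Expectation
variable {α : Type*} {β : Type*}

/-- Expectation of a nonnegative function. -/
noncomputable def expect (p : PMF α) (f : α → ℝ≥0∞) : ℝ≥0∞ := ∑' x, p x * f x

theorem expect_mono (p : PMF α) {f g : α → ℝ≥0∞} (h : ∀ x, f x ≤ g x) :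
    expect p f ≤ expect p g :=
  ENNReal.tsum_le_tsum fun x => mul_le_mul_right (h x) _

theorem expect_congr_support (p : PMF α) {f g : α → ℝ≥0∞} (h : ∀ x ∈ p.support, f x = g x) :
    expect p f = expect p g := by
  refine tsum_congr fun x => ?_
  by_cases hx : p x = 0
  · simp [hx]
  · rw [h x hx]

theorem expect_const (p : PMF α) (c : ℝ≥0∞) : expect p (fun _ => c) = c := by
  simp [expect, ENNReal.tsum_mul_right, p.tsum_coe]

theorem expect_pure (a : α) (f : α → ℝ≥0∞) : expect (PMF.pure a) f = f a := by
  unfold expect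
  rw [tsum_eq_single a]
  · simp
  · intro b hb
    simp [PMF.pure_apply, hb]

theorem expect_bind (p : PMF α) (q : α → PMF β) (f : β → ℝ≥0∞) :
    expect (p.bind q) f = expect p fun x => expect (q x) f := by
  simp only [expect, PMF.bind_apply, ← ENNReal.tsum_mul_right, ← ENNReal.tsum_mul_left]
  rw [ENNReal.tsum_comm]
  simp only [mul_assoc]

theorem expect_map (p : PMF α) (g : α → β) (f : β → ℝ≥0∞) :
    expect (p.map g) f = expect p fun x => f (g x) := by
  rw [← PMF.bind_pure_comp, expect_bind]
  simp [expect_pure]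

theorem expect_mul_left (p : PMF α) (c : ℝ≥0∞) (f : α → ℝ≥0∞) :
    expect p (fun x => c * f x) = c * expect p f := by
  simp only [expect, ← ENNReal.tsum_mul_left]
  exact tsum_congr fun x => by ring

theorem expect_add (p : PMF α) (f g : α → ℝ≥0∞) :
    expect p (fun x => f x + g x) = expect p f + expect p g := by
  simp only [expect, mul_add, ENNReal.tsum_add]

theorem expect_eq_sum [Fintype α] (p : PMF α) (f : α → ℝ≥0∞) :
    expect p f = ∑ x, p x * f x := tsum_fintype _

theorem expect_ite_eq [DecidableEq α] (p : PMF α) (y : α) (u v : ℝ≥0∞) :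
    expect p (fun x => if x = y then u else v) = p y * u + (1 - p y) * v := by
  have h1 : ∀ x, p x * (if x = y then u else v) =
      (if x = y then p y * u else 0) + (if x = y then 0 else p x) * v := by
    intro x
    by_cases h : x = y <;> simp [h]
  unfold expect
  rw [tsum_congr h1, ENNReal.tsum_add, ENNReal.tsum_mul_right, tsum_ite_eq]
  congr 2
  have h2 := p.tsum_coe
  rw [tsum_congr (fun x => (show p x = (if x = y then p y else 0) + (if x = y then 0 else p x) by
    by_cases h : x = y <;> simp [h])), ENNReal.tsum_add, tsum_ite_eq] at h2
  exact ENNReal.eq_sub_of_add_eq (p.apply_ne_top y) (by rw [add_comm]; exact h2)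

/-- Markov's inequality in the form behind the probability bounds below: a potential that is at
least 1 on the bad event bounds its probability by the potential's mean. -/
theorem toOuterMeasure_le_expect (p : PMF α) (E : Set α) (f : α → ℝ≥0∞)
    (h : ∀ x ∈ E, 1 ≤ f x) : p.toOuterMeasure E ≤ expect p f := by
  rw [PMF.toOuterMeasure_apply]
  refine ENNReal.tsum_le_tsum fun x => ?_
  by_cases hx : x ∈ E
  · rw [Set.indicator_of_mem hx]
    exact le_mul_of_one_le_right zero_le (h x hx)
  · simp [hx]

theorem le_toOuterMeasure_of_compl (p : PMF α) (E : Set α) {ε : ℝ} (hε : 0 ≤ ε)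
    (h : p.toOuterMeasure Eᶜ ≤ ENNReal.ofReal ε) :
    ENNReal.ofReal (1 - ε) ≤ p.toOuterMeasure E := by
  have h1 : (1 : ℝ≥0∞) ≤ p.toOuterMeasure E + p.toOuterMeasure Eᶜ := by
    calc (1 : ℝ≥0∞) = p.toOuterMeasure (E ∪ Eᶜ) := by
          rw [Set.union_compl_self, (PMF.toOuterMeasure_apply_eq_one_iff p _).2 (Set.subset_univ _)]
      _ ≤ _ := MeasureTheory.measure_union_le _ _
  rw [ENNReal.ofReal_sub _ hε, ENNReal.ofReal_one, tsub_le_iff_right]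
  exact h1.trans (by gcongr)

end Expectation

variable {S : Type u} {A : Type v}

/-! ### Trajectories: length, potentials, law of the last pair -/

namespace MDP

theorem expect_lengthLaw (M : MDP S A) (f : ℕ → ℝ≥0∞) :
    expect M.lengthLaw f = ∑' n, ENNReal.ofReal ((1 - M.γ) * M.γ ^ n) * f (n + 1) := by
  unfold lengthLaw
  rw [expect_map]
  refine tsum_congr fun n => ?_
  have hp : (⟨1 - M.γ, sub_nonneg.2 M.γ_lt_one.le, sub_le_self 1 M.γ_nonneg⟩ : unitInterval) ≠ 0 := by
    intro h
    have := congrArg Subtype.val h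
    have h2 := M.γ_lt_one
    simp at this
    linarith
  rw [MeasureTheory.Measure.toPMF_apply, ProbabilityTheory.geometricMeasure_singleton hp]
  congr 2
  simp [mul_comm]

/-- The hypothesis constrains the transition after every pair separately, so the rule that chooses
the actions is irrelevant. This is what later makes adaptively chosen policies harmless. -/
theorem expect_rollout_le (M : MDP S A) (π : Policy S A) (Ψ : List (S × A × S) → ℝ≥0∞)
    (hΨ : ∀ h s a, expect (M.P s a) (fun s' => Ψ (h ++ [(s, a, s')])) ≤ Ψ h) (n : ℕ) (s : S)
    (h : List (S × A × S)) :
    expect (M.rollout π n s) (fun τ => Ψ (h ++ τ)) ≤ Ψ h := by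
  induction n generalizing s h with
  | zero => simp [rollout, expect_pure]
  | succ n ih =>
    simp only [rollout, expect_bind, expect_map]
    calc _ ≤ expect (π s) (fun a => expect (M.P s a) fun s' => Ψ (h ++ [(s, a, s')])) := by
          refine expect_mono _ fun a => expect_mono _ fun s' => ?_
          have := ih s' (h ++ [(s, a, s')])
          simpa using this
      _ ≤ expect (π s) (fun _ => Ψ h) := expect_mono _ fun a => hΨ h s a
      _ = Ψ h := expect_const _ _

theorem expect_trajectoryLaw_le (M : MDP S A) (π : Policy S A) (Ψ : List (S × A × S) → ℝ≥0∞)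
    (hΨ : ∀ h s a, expect (M.P s a) (fun s' => Ψ (h ++ [(s, a, s')])) ≤ Ψ h)
    (h : List (S × A × S)) :
    expect (M.trajectoryLaw π) (fun τ => Ψ (h ++ τ)) ≤ Ψ h := by
  simp only [trajectoryLaw, expect_bind]
  calc _ ≤ expect M.lengthLaw (fun _ => expect M.ν₀ fun _ => Ψ h) :=
        expect_mono _ fun n => expect_mono _ fun s => M.expect_rollout_le π Ψ hΨ n s h
    _ = Ψ h := by simp only [expect_const]

theorem rollout_length (M : MDP S A) (π : Policy S A) (n : ℕ) (s : S) :
    ∀ τ ∈ (M.rollout π n s).support, τ.length = n := by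
  induction n generalizing s with
  | zero => simp [rollout]
  | succ n ih =>
    intro τ hτ
    simp only [rollout, PMF.mem_support_bind_iff, PMF.mem_support_map_iff] at hτ
    obtain ⟨a, -, s', -, τ', h, rfl⟩ := hτ
    simp [ih s' τ' h]

theorem expect_length (M : MDP S A) (π : Policy S A) :
    expect (M.trajectoryLaw π) (fun τ => (τ.length : ℝ≥0∞)) = ENNReal.ofReal (1 / (1 - M.γ)) := by
  have h1 : ∀ n s, expect (M.rollout π n s) (fun τ => (τ.length : ℝ≥0∞)) = n := by
    intro n s
    rw [expect_congr_support (g := fun _ => (n : ℝ≥0∞)) _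
      (fun τ hτ => by rw [M.rollout_length π n s τ hτ]), expect_const]
  simp only [trajectoryLaw, expect_bind, h1, expect_const, expect_lengthLaw]
  have hγ := M.γ_nonneg
  have hγ1 := M.γ_lt_one
  have h2 : HasSum (fun n : ℕ => (n : ℝ) * M.γ ^ n) (M.γ / (1 - M.γ) ^ 2) :=
    hasSum_coe_mul_geometric_of_norm_lt_one (by rwa [Real.norm_of_nonneg hγ])
  have h3 := (h2.add (hasSum_geometric_of_lt_one hγ hγ1)).mul_left (1 - M.γ)
  have h4 : ∀ n : ℕ, ENNReal.ofReal ((1 - M.γ) * M.γ ^ n) * ((n + 1 : ℕ) : ℝ≥0∞) =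
      ENNReal.ofReal ((1 - M.γ) * (n * M.γ ^ n + M.γ ^ n)) := by
    intro n
    have : 0 ≤ 1 - M.γ := by linarith
    rw [← ENNReal.ofReal_natCast, ← ENNReal.ofReal_mul (by positivity)]
    congr 1
    push_cast
    ring
  rw [tsum_congr h4, ← ENNReal.ofReal_tsum_of_nonneg _ h3.summable, h3.tsum_eq]
  · congr 1
    have : 1 - M.γ ≠ 0 := by linarith
    field_simp
    ring
  · intro n
    have : 0 ≤ 1 - M.γ := by linarith
    positivity

/-- Expectation of `G` after one step from `s`. -/
noncomputable def kern (M : MDP S A) (π : Policy S A) (G : S → ℝ≥0∞) (s : S) : ℝ≥0∞ :=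
  expect (π s) fun a => expect (M.P s a) G

theorem expect_stateLaw (M : MDP S A) (π : Policy S A) (n : ℕ) (G : S → ℝ≥0∞) :
    expect (M.stateLaw π n) G = expect M.ν₀ ((M.kern π)^[n] G) := by
  induction n generalizing G with
  | zero => rfl
  | succ n ih =>
    rw [Function.iterate_succ_apply, ← ih]
    simp only [stateLaw, expect_bind]
    rfl

/-- The last visited state-action pair. -/
def lastPair (τ : List (S × A × S)) : Option (S × A) := τ.getLast?.map fun x => (x.1, x.2.1)

theorem lastPair_cons_cons (x y : S × A × S) (τ : List (S × A × S)) :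
    lastPair (x :: y :: τ) = lastPair (y :: τ) := by
  simp [lastPair]

/-- The dummy head `y` makes the induction uniform: prepending a transition to a nonempty list does
not change its last pair. -/
theorem expect_rollout_lastPair_cons (M : MDP S A) (π : Policy S A) (F : Option (S × A) → ℝ≥0∞)
    (n : ℕ) (s : S) (y : S × A × S) :
    expect (M.rollout π (n + 1) s) (fun τ => F (lastPair (y :: τ))) =
      (M.kern π)^[n] (fun s => expect (π s) fun a => F (some (s, a))) s := by
  induction n generalizing s y with
  | zero => simp [rollout, expect_bind, expect_map, expect_pure, lastPair, expect_const]
  | succ n ih =>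
    rw [Function.iterate_succ_apply']
    rw [rollout]
    simp only [expect_bind, expect_map, lastPair_cons_cons, ih]
    rfl

theorem expect_rollout_lastPair (M : MDP S A) (π : Policy S A) (F : Option (S × A) → ℝ≥0∞)
    (n : ℕ) (s : S) :
    expect (M.rollout π (n + 1) s) (fun τ => F (lastPair τ)) =
      (M.kern π)^[n] (fun s => expect (π s) fun a => F (some (s, a))) s := by
  cases n with
  | zero => simp [rollout, expect_bind, expect_map, expect_pure, lastPair, expect_const]
  | succ n =>
    rw [Function.iterate_succ_apply']
    rw [rollout]
    simp only [expect_bind, expect_map, M.expect_rollout_lastPair_cons π F]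
    rfl

theorem summable_occupancy (M : MDP S A) (π : Policy S A) (s : S) (a : A) :
    Summable fun h : ℕ => M.γ ^ h * ((M.stateLaw π h s).toReal * (π s a).toReal) := by
  refine Summable.of_nonneg_of_le (fun h => ?_) (fun h => ?_)
    (summable_geometric_of_lt_one M.γ_nonneg M.γ_lt_one)
  · have := M.γ_nonneg
    positivity
  · refine mul_le_of_le_one_right (pow_nonneg M.γ_nonneg _) ?_
    refine mul_le_one₀ ?_ ENNReal.toReal_nonneg ?_
    · exact ENNReal.toReal_le_of_le_ofReal zero_le_one (by simpa using PMF.coe_le_one _ _)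
    · exact ENNReal.toReal_le_of_le_ofReal zero_le_one (by simpa using PMF.coe_le_one _ _)

theorem occupancy_nonneg (M : MDP S A) (π : Policy S A) (s : S) (a : A) :
    0 ≤ M.occupancy π s a := by
  have := M.γ_nonneg
  have h2 := M.γ_lt_one
  exact mul_nonneg (by linarith) (tsum_nonneg fun h => by positivity)

theorem ofReal_occupancy (M : MDP S A) (π : Policy S A) (s : S) (a : A) :
    ENNReal.ofReal (M.occupancy π s a) =
      ∑' n, ENNReal.ofReal ((1 - M.γ) * M.γ ^ n) * (M.stateLaw π n s * π s a) := by
  have hγ := M.γ_nonneg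
  have h2 : 0 ≤ 1 - M.γ := by linarith [M.γ_lt_one]
  rw [occupancy, ← tsum_mul_left, ENNReal.ofReal_tsum_of_nonneg]
  · refine tsum_congr fun n => ?_
    rw [← mul_assoc, ENNReal.ofReal_mul (by positivity), ENNReal.ofReal_mul ENNReal.toReal_nonneg,
      ENNReal.ofReal_toReal (PMF.apply_ne_top _ _), ENNReal.ofReal_toReal (PMF.apply_ne_top _ _)]
  · intro n
    positivity
  · exact (M.summable_occupancy π s a).mul_left _

/-- A trajectory of length n + 1 ends with the pair visited at time n, and this length has
probability (1-γ)γ^n, the weight of time n in the occupancy measure. The value `F none` does not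
enter because lengths are at least 1. -/
theorem expect_trajectoryLaw_lastPair [Fintype S] [Fintype A] (M : MDP S A) (π : Policy S A)
    (F : Option (S × A) → ℝ≥0∞) :
    expect (M.trajectoryLaw π) (fun τ => F (lastPair τ)) =
      ∑ s, ∑ a, ENNReal.ofReal (M.occupancy π s a) * F (some (s, a)) := by
  simp only [trajectoryLaw, expect_bind, expect_lengthLaw, expect_rollout_lastPair]
  have h1 : ∀ n, expect M.ν₀ (fun s => (M.kern π)^[n]
      (fun s => expect (π s) fun a => F (some (s, a))) s) =
      ∑ s, ∑ a, M.stateLaw π n s * π s a * F (some (s, a)) := by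
    intro n
    have := (M.expect_stateLaw π n (fun s => expect (π s) fun a => F (some (s, a)))).symm
    refine this.trans ?_
    simp only [expect_eq_sum, Finset.mul_sum, mul_assoc]
  simp only [h1, ofReal_occupancy, Finset.mul_sum, ← ENNReal.tsum_mul_right]
  rw [Summable.tsum_finsetSum (fun _ _ => ENNReal.summable)]
  refine Finset.sum_congr rfl fun s _ => ?_
  rw [Summable.tsum_finsetSum (fun _ _ => ENNReal.summable)]
  refine Finset.sum_congr rfl fun a _ => tsum_congr fun n => by ring

end MDP

/-! ### Law of the whole run -/

variable [Fintype S] [DecidableEq S] [Fintype A] [Nonempty A] [DecidableEq A]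

theorem expect_law_succ (M : MDP S A) (I : Input S A) (k : ℕ)
    (f : List (List (S × A × S)) → ℝ≥0∞) :
    expect (law M I (k + 1)) f = expect (law M I k) fun τs =>
      expect (M.trajectoryLaw (run M.γ I τs).policy) fun τ => f (τs ++ [τ]) := by
  simp only [law, expect_bind, expect_map]

/-- Potentials of the concatenated history inherit the supermartingale property across iterations,
although each policy is computed from the earlier trajectories. -/
theorem expect_law_flatten_le (M : MDP S A) (I : Input S A) (k : ℕ)
    (Ψ : List (S × A × S) → ℝ≥0∞)
    (hΨ : ∀ h s a, expect (M.P s a) (fun s' => Ψ (h ++ [(s, a, s')])) ≤ Ψ h) :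
    expect (law M I k) (fun τs => Ψ τs.flatten) ≤ Ψ [] := by
  induction k with
  | zero => simp [law, expect_pure]
  | succ k ih =>
    rw [expect_law_succ]
    refine le_trans (expect_mono _ fun τs => ?_) ih
    simpa using M.expect_trajectoryLaw_le _ Ψ hΨ τs.flatten

theorem expect_law_length (M : MDP S A) (I : Input S A) (k : ℕ) :
    expect (law M I k) (fun τs => (τs.flatten.length : ℝ≥0∞)) =
      k * ENNReal.ofReal (1 / (1 - M.γ)) := by
  induction k with
  | zero => simp [law, expect_pure]
  | succ k ih =>
    rw [expect_law_succ]
    simp only [List.flatten_append, List.length_append, Nat.cast_add, expect_add, expect_const,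
      List.flatten_cons, List.flatten_nil, List.append_nil, M.expect_length, ih]
    push_cast
    ring

theorem law_length (M : MDP S A) (I : Input S A) (k : ℕ) :
    ∀ τs ∈ (law M I k).support, τs.length = k := by
  induction k with
  | zero => simp [law]
  | succ k ih =>
    intro τs h
    simp only [law, PMF.mem_support_bind_iff, PMF.mem_support_map_iff] at h
    obtain ⟨τs', h1, τ, -, rfl⟩ := h
    simp [ih τs' h1]

theorem sum_toReal {α : Type*} [Fintype α] (p : PMF α) : ∑ x, (p x).toReal = 1 := by
  rw [← ENNReal.toReal_sum (fun x _ => p.apply_ne_top x), ← tsum_fintype (L := .unconditional _),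
    p.tsum_coe, ENNReal.toReal_one]

theorem sum_toReal_mul_mem_Icc {α : Type*} [Fintype α] (p : PMF α) {f : α → ℝ} {b : ℝ}
    (hf : ∀ x, f x ∈ Set.Icc 0 b) : ∑ x, (p x).toReal * f x ∈ Set.Icc 0 b := by
  constructor
  · exact Finset.sum_nonneg fun x _ => mul_nonneg ENNReal.toReal_nonneg (hf x).1
  · calc _ ≤ ∑ x, (p x).toReal * b := Finset.sum_le_sum fun x _ =>
          mul_le_mul_of_nonneg_left (hf x).2 ENNReal.toReal_nonneg
      _ = b := by rw [← Finset.sum_mul, sum_toReal, one_mul]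

theorem bind_toReal {α β : Type*} [Fintype α] (p : PMF α) (q : α → PMF β) (y : β) :
    (p.bind q y).toReal = ∑ x, (p x).toReal * (q x y).toReal := by
  rw [PMF.bind_apply, tsum_fintype, ENNReal.toReal_sum
    (fun x _ => ENNReal.mul_ne_top (p.apply_ne_top x) ((q x).apply_ne_top y))]
  simp [ENNReal.toReal_mul]

/-! ### Multiplicative weights: stability and regret -/

section MultiplicativeWeights
variable {A : Type v} [Fintype A]

theorem mwUpdate_toReal (η : ℝ) (p : PMF A) (q : A → ℝ) (a : A) :
    (mwUpdate η p q a).toReal =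
      (p a).toReal * Real.exp (-η * q a) / ∑ b, (p b).toReal * Real.exp (-η * q b) := by
  rw [mwUpdate, PMF.normalize_apply, ENNReal.toReal_mul, ENNReal.toReal_mul,
    ENNReal.toReal_ofReal (Real.exp_pos _).le, ENNReal.toReal_inv, tsum_fintype,
    ENNReal.toReal_sum
      (fun b _ => ENNReal.mul_ne_top (p.apply_ne_top b) ENNReal.ofReal_ne_top), div_eq_mul_inv]
  simp only [ENNReal.toReal_mul, ENNReal.toReal_ofReal (Real.exp_pos _).le]

theorem partition_pos (η : ℝ) (p : PMF A) (q : A → ℝ) :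
    0 < ∑ b, (p b).toReal * Real.exp (-η * q b) := by
  obtain ⟨a, ha⟩ := p.support_nonempty
  refine Finset.sum_pos' (fun b _ => by positivity) ⟨a, Finset.mem_univ _, ?_⟩
  exact mul_pos (ENNReal.toReal_pos ha (p.apply_ne_top a)) (Real.exp_pos _)

theorem mwUpdate_pos (η : ℝ) (p : PMF A) (q : A → ℝ) {a : A} (h : 0 < (p a).toReal) :
    0 < (mwUpdate η p q a).toReal := by
  rw [mwUpdate_toReal]
  exact div_pos (mul_pos h (Real.exp_pos _)) (partition_pos η p q)

/-- For nonnegative costs the normalizing sum is at most 1, so the new weight is at least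
p(a)exp(-ηq(a)) ≥ (1 - ηb)p(a). Only this side of stability is needed, and there is no upper
restriction on η. -/
theorem sub_mwUpdate_le {η b : ℝ} (hη : 0 ≤ η) (p : PMF A) (q : A → ℝ)
    (hq : ∀ a, q a ∈ Set.Icc 0 b) (a : A) :
    (p a).toReal - (mwUpdate η p q a).toReal ≤ η * b * (p a).toReal := by
  rw [mwUpdate_toReal]
  have hZ := partition_pos η p q
  have hZ1 : ∑ b, (p b).toReal * Real.exp (-η * q b) ≤ 1 := by
    refine (sum_toReal_mul_mem_Icc p (b := 1) fun x => ⟨(Real.exp_pos _).le, ?_⟩).2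
    rw [Real.exp_le_one_iff]
    nlinarith [(hq x).1]
  have h1 : (p a).toReal * Real.exp (-η * q a) ≤
      (p a).toReal * Real.exp (-η * q a) / ∑ b, (p b).toReal * Real.exp (-η * q b) :=
    le_div_self (by positivity) hZ hZ1
  have h2 : 1 - η * b ≤ Real.exp (-η * q a) := by
    have := Real.add_one_le_exp (-η * q a)
    have := mul_le_mul_of_nonneg_left (hq a).2 hη
    linarith
  have h3 := mul_le_mul_of_nonneg_left h2 (ENNReal.toReal_nonneg (a := p a))
  linarith

theorem sum_sub_mwUpdate_mul_le {η b : ℝ} (hη : 0 ≤ η) (p : PMF A) (q f : A → ℝ)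
    (hq : ∀ a, q a ∈ Set.Icc 0 b) {b' : ℝ} (hf : ∀ a, f a ∈ Set.Icc 0 b') :
    ∑ a, ((p a).toReal - (mwUpdate η p q a).toReal) * f a ≤ η * b * b' := by
  obtain ⟨a₀, -⟩ := p.support_nonempty
  have hb : 0 ≤ b := (hq a₀).1.trans (hq a₀).2
  calc _ ≤ ∑ a, η * b * ((p a).toReal * f a) := by
        refine Finset.sum_le_sum fun a _ => ?_
        have := mul_le_mul_of_nonneg_right (sub_mwUpdate_le hη p q hq a) (hf a).1
        linarith
    _ = η * b * ∑ a, (p a).toReal * f a := by rw [Finset.mul_sum]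
    _ ≤ η * b * b' := mul_le_mul_of_nonneg_left (sum_toReal_mul_mem_Icc p hf).2 (by positivity)

/-- The log-ratio of new to old weights is -ηq - log Z. Averaging it under the new weights gives a
relative entropy, which is nonnegative; this removes log Z. -/
theorem mwUpdate_step (η : ℝ) (p r : PMF A) (q : A → ℝ) (hp : ∀ a, 0 < (p a).toReal) :
    η * ∑ a, ((mwUpdate η p q a).toReal - (r a).toReal) * q a ≤
      ∑ a, (r a).toReal * (Real.log (mwUpdate η p q a).toReal - Real.log (p a).toReal) := by
  set Z := ∑ b, (p b).toReal * Real.exp (-η * q b) with hZd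
  have hZ : 0 < Z := partition_pos η p q
  have hlog : ∀ a, Real.log (mwUpdate η p q a).toReal - Real.log (p a).toReal =
      -η * q a - Real.log Z := by
    intro a
    rw [mwUpdate_toReal, ← hZd, Real.log_div (mul_pos (hp a) (Real.exp_pos _)).ne' hZ.ne',
      Real.log_mul (hp a).ne' (Real.exp_pos _).ne', Real.log_exp]
    ring
  -- Gibbs' inequality, obtained termwise from log x ≥ 1 - 1/x.
  have hKL : 0 ≤ ∑ a, (mwUpdate η p q a).toReal *
      (Real.log (mwUpdate η p q a).toReal - Real.log (p a).toReal) := by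
    calc (0 : ℝ) = ∑ a, ((mwUpdate η p q a).toReal - (p a).toReal) := by
          rw [Finset.sum_sub_distrib, sum_toReal, sum_toReal, sub_self]
      _ ≤ _ := by
          refine Finset.sum_le_sum fun a _ => ?_
          have hx := mwUpdate_pos η p q (hp a)
          rw [← Real.log_div hx.ne' (hp a).ne']
          have h1 := Real.one_sub_inv_le_log_of_pos (div_pos hx (hp a))
          have h2 := mul_le_mul_of_nonneg_left h1 hx.le
          have h3 : (mwUpdate η p q a).toReal *
              (1 - ((mwUpdate η p q a).toReal / (p a).toReal)⁻¹) =
              (mwUpdate η p q a).toReal - (p a).toReal := by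
            field_simp
          linarith
  have h1 : ∀ w : PMF A, ∑ a, (w a).toReal * (-η * q a - Real.log Z) =
      -η * ∑ a, (w a).toReal * q a - Real.log Z := by
    intro w
    simp only [mul_sub, Finset.sum_sub_distrib, ← Finset.sum_mul, sum_toReal, one_mul,
      Finset.mul_sum]
    congr 1
    exact Finset.sum_congr rfl fun a _ => by ring
  simp only [hlog, h1] at hKL ⊢
  simp only [sub_mul, Finset.sum_sub_distrib]
  linarith

/-- The cost `q k` is charged to the already updated `p (k + 1)`, so the log-ratios telescope
without a second-order term in η. Such terms appear only later, from comparing consecutive policies.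
-/
theorem be_the_leader [Nonempty A] {η : ℝ} (hη : 0 < η) (p : ℕ → PMF A) (q : ℕ → A → ℝ) (r : PMF A)
    (K : ℕ) (h0 : p 0 = PMF.uniformOfFintype A)
    (hstep : ∀ k < K, p (k + 1) = mwUpdate η (p k) (q k)) :
    ∑ k ∈ Finset.range K, ∑ a, ((p (k + 1) a).toReal - (r a).toReal) * q k a ≤
      Real.log (Fintype.card A) / η := by
  have h00 : ∀ a, (p 0 a).toReal = (Fintype.card A : ℝ)⁻¹ := by
    intro a
    simp [h0]
  have hcard : (0 : ℝ) < Fintype.card A := by exact_mod_cast Fintype.card_pos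
  have hpos : ∀ k ≤ K, ∀ a, 0 < (p k a).toReal := by
    intro k
    induction k with
    | zero => intro _ a; rw [h00]; positivity
    | succ k ih =>
      intro hk a
      rw [hstep k hk]
      exact mwUpdate_pos _ _ _ (ih (by omega) a)
  have hle1 : ∀ a, (p K a).toReal ≤ 1 := fun a =>
    ENNReal.toReal_le_of_le_ofReal zero_le_one (by simpa using PMF.coe_le_one _ _)
  rw [le_div_iff₀ hη, mul_comm, Finset.mul_sum]
  calc _ ≤ ∑ k ∈ Finset.range K, ∑ a, (r a).toReal *
          (Real.log (p (k + 1) a).toReal - Real.log (p k a).toReal) := by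
        refine Finset.sum_le_sum fun k hk => ?_
        rw [Finset.mem_range] at hk
        rw [hstep k hk]
        exact mwUpdate_step η (p k) r (q k) (hpos k hk.le)
    _ = ∑ a, (r a).toReal * (Real.log (p K a).toReal - Real.log (p 0 a).toReal) := by
        rw [Finset.sum_comm]
        refine Finset.sum_congr rfl fun a _ => ?_
        rw [← Finset.mul_sum, Finset.sum_range_sub (fun k => Real.log (p k a).toReal)]
    _ ≤ ∑ a, (r a).toReal * Real.log (Fintype.card A) := by
        refine Finset.sum_le_sum fun a _ => mul_le_mul_of_nonneg_left ?_ ENNReal.toReal_nonneg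
        rw [h00, Real.log_inv]
        have := Real.log_nonpos (hpos K le_rfl a).le (hle1 a)
        linarith
    _ = Real.log (Fintype.card A) := by rw [← Finset.sum_mul, sum_toReal, one_mul]

end MultiplicativeWeights

/-! ### Occupancy measures and the deterministic regret decomposition -/

namespace MDP
variable {S : Type u} {A : Type v}

/-- Expected value of `f` at the next state. -/
noncomputable def next [Fintype S] (M : MDP S A) (f : S → ℝ) (s : S) (a : A) : ℝ :=
  ∑ s', (M.P s a s').toReal * f s'

/-- Discounted state occupancy. -/
noncomputable def stateOcc (M : MDP S A) (π : Policy S A) (s : S) : ℝ :=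
  (1 - M.γ) * ∑' h : ℕ, M.γ ^ h * (M.stateLaw π h s).toReal

theorem occupancy_eq (M : MDP S A) (π : Policy S A) (s : S) (a : A) :
    M.occupancy π s a = M.stateOcc π s * (π s a).toReal := by
  simp only [occupancy, stateOcc, ← mul_assoc, tsum_mul_right]

theorem summable_stateOcc (M : MDP S A) (π : Policy S A) (s : S) :
    Summable fun h : ℕ => M.γ ^ h * (M.stateLaw π h s).toReal := by
  refine Summable.of_nonneg_of_le (fun h => ?_) (fun h => ?_)
    (summable_geometric_of_lt_one M.γ_nonneg M.γ_lt_one)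
  · have := M.γ_nonneg
    positivity
  · refine mul_le_of_le_one_right (pow_nonneg M.γ_nonneg _) ?_
    exact ENNReal.toReal_le_of_le_ofReal zero_le_one (by simpa using PMF.coe_le_one _ _)

theorem stateOcc_nonneg (M : MDP S A) (π : Policy S A) (s : S) : 0 ≤ M.stateOcc π s := by
  have := M.γ_nonneg
  have h2 := M.γ_lt_one
  exact mul_nonneg (by linarith) (tsum_nonneg fun h => by positivity)

variable [Fintype S]

theorem hasSum_stateOcc (M : MDP S A) (π : Policy S A) (f : S → ℝ) :
    HasSum (fun h : ℕ => (1 - M.γ) * (M.γ ^ h * ∑ s, (M.stateLaw π h s).toReal * f s))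
      (∑ s, M.stateOcc π s * f s) := by
  have h := hasSum_sum (s := Finset.univ) fun s (_ : s ∈ Finset.univ) =>
    (((M.summable_stateOcc π s).hasSum.mul_left (1 - M.γ)).mul_right (f s))
  simpa only [Finset.mul_sum, mul_assoc, stateOcc] using h

theorem sum_stateOcc (M : MDP S A) (π : Policy S A) : ∑ s, M.stateOcc π s = 1 := by
  have h := M.hasSum_stateOcc π (fun _ => 1)
  simp only [mul_one, sum_toReal] at h
  have h2 := (hasSum_geometric_of_lt_one M.γ_nonneg M.γ_lt_one).mul_left (1 - M.γ)
  rw [mul_inv_cancel₀ (by linarith [M.γ_lt_one])] at h2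
  exact h.unique h2

theorem stateOcc_mul_le (M : MDP S A) (π : Policy S A) {f : S → ℝ} {b : ℝ} (hf : ∀ s, f s ≤ b) :
    ∑ s, M.stateOcc π s * f s ≤ b := by
  calc _ ≤ ∑ s, M.stateOcc π s * b :=
        Finset.sum_le_sum fun s _ => mul_le_mul_of_nonneg_left (hf s) (M.stateOcc_nonneg π s)
    _ = b := by rw [← Finset.sum_mul, sum_stateOcc, one_mul]

theorem next_mem_Icc (M : MDP S A) {f : S → ℝ} {b : ℝ} (hf : ∀ s, f s ∈ Set.Icc 0 b)
    (s : S) (a : A) : M.next f s a ∈ Set.Icc 0 b :=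
  sum_toReal_mul_mem_Icc _ hf

variable [Fintype A]

theorem sum_occupancy_mul (M : MDP S A) (π : Policy S A) (F : S → A → ℝ) :
    ∑ s, ∑ a, M.occupancy π s a * F s a =
      ∑ s, M.stateOcc π s * ∑ a, (π s a).toReal * F s a := by
  simp only [occupancy_eq, Finset.mul_sum, mul_assoc]

theorem sum_occupancy_mul_state (M : MDP S A) (π : Policy S A) (f : S → ℝ) :
    ∑ s, ∑ a, M.occupancy π s a * f s = ∑ s, M.stateOcc π s * f s := by
  rw [sum_occupancy_mul]
  simp only [← Finset.sum_mul, sum_toReal, one_mul]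

theorem stateLaw_succ_sum (M : MDP S A) (π : Policy S A) (h : ℕ) (f : S → ℝ) :
    ∑ s, (M.stateLaw π (h + 1) s).toReal * f s =
      ∑ s, (M.stateLaw π h s).toReal * ∑ a, (π s a).toReal * M.next f s a := by
  simp only [stateLaw, bind_toReal, next, Finset.mul_sum, Finset.sum_mul]
  rw [Finset.sum_comm]
  refine Finset.sum_congr rfl fun s _ => ?_
  rw [Finset.sum_comm]
  exact Finset.sum_congr rfl fun a _ => Finset.sum_congr rfl fun s' _ => by ring

/-- The flow constraint satisfied by occupancy measures. -/
theorem occupancy_flow (M : MDP S A) (π : Policy S A) (f : S → ℝ) :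
    ∑ s, ∑ a, M.occupancy π s a * (f s - M.γ * M.next f s a) =
      (1 - M.γ) * ∑ s, (M.ν₀ s).toReal * f s := by
  have h1 := M.hasSum_stateOcc π f
  have h2 := (M.hasSum_stateOcc π (fun s => ∑ a, (π s a).toReal * M.next f s a)).mul_left M.γ
  simp only [← M.stateLaw_succ_sum π] at h2
  have h3 := (hasSum_nat_add_iff' 1).2 h1
  rw [Finset.sum_range_one] at h3
  have h4 : ∀ n, M.γ * ((1 - M.γ) * (M.γ ^ n * ∑ s, (M.stateLaw π (n + 1) s).toReal * f s)) =
      (1 - M.γ) * (M.γ ^ (n + 1) * ∑ s, (M.stateLaw π (n + 1) s).toReal * f s) := by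
    intro n; ring
  rw [funext h4] at h2
  have h5 := h2.unique h3
  simp only [mul_sub, Finset.sum_sub_distrib]
  rw [sum_occupancy_mul_state, sum_occupancy_mul]
  have h6 : ∑ s, M.stateOcc π s * ∑ a, (π s a).toReal * (M.γ * M.next f s a) =
      M.γ * ∑ s, M.stateOcc π s * ∑ a, (π s a).toReal * M.next f s a := by
    simp only [Finset.mul_sum]
    exact Finset.sum_congr rfl fun s _ => Finset.sum_congr rfl fun a _ => by ring
  rw [h6, h5]
  simp [stateLaw]

/-- Hybrid argument: replacing one policy by the other at a single time costs at most t, since the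
continuation value again lies in [0, b]. -/
theorem stateLaw_diff_le (M : MDP S A) (π π' : Policy S A) {t b : ℝ}
    (hπ : ∀ s, ∀ g : A → ℝ, (∀ a, g a ∈ Set.Icc 0 b) →
      ∑ a, ((π s a).toReal - (π' s a).toReal) * g a ≤ t) (h : ℕ) (f : S → ℝ)
    (hf : ∀ s, f s ∈ Set.Icc 0 b) :
    ∑ s, (M.stateLaw π h s).toReal * f s - ∑ s, (M.stateLaw π' h s).toReal * f s ≤ h * t := by
  induction h generalizing f with
  | zero => simp [stateLaw]
  | succ h ih =>
    rw [stateLaw_succ_sum, stateLaw_succ_sum]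
    have h1 := ih (fun s => ∑ a, (π s a).toReal * M.next f s a)
      fun s => sum_toReal_mul_mem_Icc _ fun a => M.next_mem_Icc hf s a
    have h2 : ∑ s, (M.stateLaw π' h s).toReal * ∑ a, (π s a).toReal * M.next f s a -
        ∑ s, (M.stateLaw π' h s).toReal * ∑ a, (π' s a).toReal * M.next f s a ≤ t := by
      rw [← Finset.sum_sub_distrib]
      calc _ ≤ ∑ s, (M.stateLaw π' h s).toReal * t := by
            refine Finset.sum_le_sum fun s _ => ?_
            rw [← mul_sub, ← Finset.sum_sub_distrib]
            simp only [← sub_mul]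
            exact mul_le_mul_of_nonneg_left (hπ s _ fun a => M.next_mem_Icc hf s a)
              ENNReal.toReal_nonneg
        _ = t := by rw [← Finset.sum_mul, sum_toReal, one_mul]
    push_cast
    linarith

theorem stateOcc_diff_le (M : MDP S A) (π π' : Policy S A) {t b : ℝ}
    (hπ : ∀ s, ∀ g : A → ℝ, (∀ a, g a ∈ Set.Icc 0 b) →
      ∑ a, ((π s a).toReal - (π' s a).toReal) * g a ≤ t) (f : S → ℝ)
    (hf : ∀ s, f s ∈ Set.Icc 0 b) :
    ∑ s, M.stateOcc π s * f s - ∑ s, M.stateOcc π' s * f s ≤ M.γ / (1 - M.γ) * t := by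
  have hγ := M.γ_nonneg
  have hγ1 := M.γ_lt_one
  have h1 := (M.hasSum_stateOcc π f).sub (M.hasSum_stateOcc π' f)
  have h2 : HasSum (fun n : ℕ => (n : ℝ) * M.γ ^ n) (M.γ / (1 - M.γ) ^ 2) :=
    hasSum_coe_mul_geometric_of_norm_lt_one (by rwa [Real.norm_of_nonneg hγ])
  have h3 := h2.mul_left ((1 - M.γ) * t)
  have h4 := hasSum_le (fun n => ?_) h1 h3
  · refine h4.trans_eq ?_
    have : 1 - M.γ ≠ 0 := by linarith
    field_simp
  · have h5 := M.stateLaw_diff_le π π' hπ n f hf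
    have h6 := mul_le_mul_of_nonneg_left h5 (mul_nonneg (sub_nonneg.2 hγ1.le) (pow_nonneg hγ n))
    linarith

theorem sum_occupancy_mul_le (M : MDP S A) (π : Policy S A) {F : S → A → ℝ} {b : ℝ}
    (hF : ∀ s a, F s a ≤ b) : ∑ s, ∑ a, M.occupancy π s a * F s a ≤ b := by
  rw [sum_occupancy_mul]
  refine M.stateOcc_mul_le π fun s => ?_
  calc _ ≤ ∑ a, (π s a).toReal * b := Finset.sum_le_sum fun a _ =>
        mul_le_mul_of_nonneg_left (hF s a) ENNReal.toReal_nonneg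
    _ = b := by rw [← Finset.sum_mul, sum_toReal, one_mul]

/-- Regret of optimistic policy iteration with multiplicative weights. -/
theorem optimistic_regret [Nonempty A] (M : MDP S A) {η : ℝ} (hη : 0 < η) (K : ℕ)
    (π : ℕ → Policy S A) (V : ℕ → S → ℝ) (c Q : ℕ → S → A → ℝ)
    (h0 : ∀ s, π 0 s = PMF.uniformOfFintype A)
    (hπ : ∀ k < K, ∀ s, π (k + 1) s = mwUpdate η (π k s) (Q k s))
    (hV : ∀ k < K, ∀ s, V (k + 1) s = ∑ a, (π (k + 1) s a).toReal * Q k s a)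
    (hVb : ∀ k ≤ K, ∀ s, V k s ∈ Set.Icc 0 (1 / (1 - M.γ)))
    (hQb : ∀ k < K, ∀ s a, Q k s a ∈ Set.Icc 0 (1 / (1 - M.γ)))
    (hopt : ∀ k < K, ∀ s a, Q k s a ≤ c k s a + M.γ * M.next (V k) s a)
    (πstar : Policy S A) :
    ∑ k ∈ Finset.range K, ∑ s, ∑ a, c k s a * (M.occupancy (π k) s a - M.occupancy πstar s a) ≤
      ∑ k ∈ Finset.range K, ∑ s, ∑ a, M.occupancy (π k) s a *
        (c k s a + M.γ * M.next (V k) s a - Q k s a) +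
      2 * (1 / (1 - M.γ)) + Real.log (Fintype.card A) / η + η * K * (1 / (1 - M.γ)) ^ 3 := by
  have hγ := M.γ_nonneg
  have hγ1 : 0 < 1 - M.γ := by linarith [M.γ_lt_one]
  set B := 1 / (1 - M.γ) with hB
  have hB0 : 0 < B := by positivity
  -- per-iteration decomposition
  have hdec : ∀ k < K, ∑ s, ∑ a, c k s a * (M.occupancy (π k) s a - M.occupancy πstar s a) ≤
      ∑ s, ∑ a, M.occupancy (π k) s a * (c k s a + M.γ * M.next (V k) s a - Q k s a) +
      (∑ s, M.stateOcc (π k) s * V (k + 1) s - ∑ s, M.stateOcc (π k) s * V k s + η * B * B) +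
      ∑ s, M.stateOcc πstar s * (V k s - V (k + 1) s +
        ∑ a, ((π (k + 1) s a).toReal - (πstar s a).toReal) * Q k s a) := by
    intro k hk
    -- The initial term comes from the flow constraint for `V k`. It does not depend on ρ, so it
    -- cancels between learner and comparator.
    have e1 : ∀ ρ : Policy S A, ∑ s, ∑ a, c k s a * M.occupancy ρ s a =
        ∑ s, ∑ a, M.occupancy ρ s a * (c k s a + M.γ * M.next (V k) s a - Q k s a) +
        (1 - M.γ) * ∑ s, (M.ν₀ s).toReal * V k s +
        ∑ s, M.stateOcc ρ s * (∑ a, (ρ s a).toReal * Q k s a - V k s) := by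
      intro ρ
      rw [← M.occupancy_flow ρ (V k)]
      simp only [mul_sub, Finset.sum_sub_distrib]
      rw [← M.sum_occupancy_mul, ← M.sum_occupancy_mul_state]
      have : ∀ s a, c k s a * M.occupancy ρ s a =
        M.occupancy ρ s a * (c k s a + M.γ * M.next (V k) s a) -
          M.occupancy ρ s a * (M.γ * M.next (V k) s a) := fun s a => by ring
      simp only [this, Finset.sum_sub_distrib]
      ring
    have e2 : 0 ≤ ∑ s, ∑ a, M.occupancy πstar s a *
        (c k s a + M.γ * M.next (V k) s a - Q k s a) :=
      Finset.sum_nonneg fun s _ => Finset.sum_nonneg fun a _ =>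
        mul_nonneg (M.occupancy_nonneg _ _ _) (by linarith [hopt k hk s a])
    -- `V (k + 1)` averages `Q k` under the next policy, so replacing π k by π (k + 1) costs one
    -- stability term ηB².
    have e3 : ∑ s, M.stateOcc (π k) s * (∑ a, (π k s a).toReal * Q k s a - V k s) ≤
        ∑ s, M.stateOcc (π k) s * V (k + 1) s - ∑ s, M.stateOcc (π k) s * V k s + η * B * B := by
      have : ∑ s, M.stateOcc (π k) s * (∑ a, (π k s a).toReal * Q k s a - V (k + 1) s) ≤
          η * B * B := by
        refine M.stateOcc_mul_le _ fun s => ?_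
        rw [hV k hk, ← Finset.sum_sub_distrib]
        simp only [← sub_mul]
        rw [hπ k hk]
        exact sum_sub_mwUpdate_mul_le hη.le _ _ _ (hQb k hk s) (hQb k hk s)
      simp only [mul_sub, Finset.sum_sub_distrib] at this ⊢
      linarith
    have e4 : ∑ s, M.stateOcc πstar s * (∑ a, (πstar s a).toReal * Q k s a - V k s) =
        - ∑ s, M.stateOcc πstar s * (V k s - V (k + 1) s +
        ∑ a, ((π (k + 1) s a).toReal - (πstar s a).toReal) * Q k s a) := by
      rw [← Finset.sum_neg_distrib]
      refine Finset.sum_congr rfl fun s _ => ?_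
      rw [hV k hk]
      simp only [sub_mul, Finset.sum_sub_distrib]
      ring
    simp only [mul_sub, Finset.sum_sub_distrib] at e1 e2 e3 e4 ⊢
    rw [e1 (π k), e1 πstar]
    linarith
  have hstar : ∑ k ∈ Finset.range K, ∑ s, M.stateOcc πstar s * (V k s - V (k + 1) s +
      ∑ a, ((π (k + 1) s a).toReal - (πstar s a).toReal) * Q k s a) ≤
      B + Real.log (Fintype.card A) / η := by
    rw [Finset.sum_comm]
    simp only [← Finset.mul_sum]
    refine M.stateOcc_mul_le _ fun s => ?_
    rw [Finset.sum_add_distrib, Finset.sum_range_sub' (fun k => V k s)]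
    have h1 := be_the_leader hη (fun k => π k s) (fun k => Q k s) (πstar s) K (h0 s)
      fun k hk => hπ k hk s
    have h2 := (hVb 0 (Nat.zero_le _) s).2
    have h3 := (hVb K le_rfl s).1
    linarith
  -- Telescoping requires evaluating `V (k + 1)` under the occupancy of the next policy. This change
  -- costs γB·ηB², and together with the ηB² above it amounts to ηB³, because 1 + γB = B.
  have habel : ∀ j ≤ K, ∑ k ∈ Finset.range j,
      (∑ s, M.stateOcc (π k) s * V (k + 1) s - ∑ s, M.stateOcc (π k) s * V k s + η * B * B) ≤
      ∑ s, M.stateOcc (π j) s * V j s - ∑ s, M.stateOcc (π 0) s * V 0 s + j * (η * B ^ 3) := by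
    intro j
    induction j with
    | zero => simp
    | succ j ih =>
      intro hj
      rw [Finset.sum_range_succ]
      have h1 := ih (by omega)
      have h2 := M.stateOcc_diff_le (π j) (π (j + 1)) (t := η * B * B) (b := B)
        (fun s g hg => by
          rw [hπ j (by omega)]
          exact sum_sub_mwUpdate_mul_le hη.le _ _ _ (hQb j (by omega) s) hg)
        (V (j + 1)) (hVb (j + 1) hj)
      have h3 : M.γ / (1 - M.γ) * (η * B * B) + η * B * B = η * B ^ 3 := by
        rw [hB]; field_simp; ring
      push_cast
      linarith
  have h1 : ∑ s, M.stateOcc (π K) s * V K s ≤ B :=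
    M.stateOcc_mul_le _ fun s => (hVb K le_rfl s).2
  have h2 : 0 ≤ ∑ s, M.stateOcc (π 0) s * V 0 s :=
    Finset.sum_nonneg fun s _ => mul_nonneg (M.stateOcc_nonneg _ _) (hVb 0 (Nat.zero_le _) s).1
  have h3 := habel K le_rfl
  have h4 := Finset.sum_le_sum fun k hk => hdec k (Finset.mem_range.1 hk)
  rw [Finset.sum_add_distrib, Finset.sum_add_distrib] at h4
  linarith

end MDP

/-! ### Visit counts and the round-robin datasets -/

section Counts
variable {S : Type u} {A : Type v} [DecidableEq S] [DecidableEq A]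

/-- The successor states of the visits to `(s, a)`, in order. -/
def successors (s : S) (a : A) (h : List (S × A × S)) : List S :=
  h.filterMap fun x => if x.1 = s ∧ x.2.1 = a then some x.2.2 else none

/-- Number of occurrences of `y` among the entries whose position, counted from one, is congruent
to `ℓ` modulo `L`. -/
def hits (L ℓ : ℕ) (y : S) (l : List S) : ℕ :=
  (l.zipIdx 1).countP fun x => x.2 % L = ℓ ∧ x.1 = y

/-- Number of the first `n` visits that are stored in the dataset `ℓ`. -/
def slots (L ℓ n : ℕ) : ℕ := Nat.count (fun i => (i + 1) % L = ℓ) n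

theorem slots_succ (L ℓ n : ℕ) :
    slots L ℓ (n + 1) = slots L ℓ n + if (n + 1) % L = ℓ then 1 else 0 := Nat.count_succ _ _

theorem slots_mono (L ℓ : ℕ) : Monotone (slots L ℓ) := Nat.count_monotone _

theorem hits_nil (L ℓ : ℕ) (y : S) : hits L ℓ y [] = 0 := rfl

theorem hits_concat (L ℓ : ℕ) (y : S) (l : List S) (x : S) :
    hits L ℓ y (l ++ [x]) = hits L ℓ y l + if (l.length + 1) % L = ℓ ∧ x = y then 1 else 0 := by
  simp [hits, List.zipIdx_append, List.countP_append, List.countP_singleton, add_comm 1]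

theorem hits_eq_zero {L ℓ : ℕ} {y : S} {l : List S} (h : y ∉ l) : hits L ℓ y l = 0 := by
  induction l using List.reverseRecOn with
  | nil => rfl
  | append_singleton l x ih =>
    simp only [List.mem_append, List.mem_singleton, not_or] at h
    rw [hits_concat, ih h.1, if_neg (fun h' => h.2 h'.2.symm)]

theorem sum_hits [Fintype S] (L ℓ : ℕ) (l : List S) :
    ∑ y, hits L ℓ y l = slots L ℓ l.length := by
  induction l using List.reverseRecOn with
  | nil => simp [hits_nil, slots]
  | append_singleton l x ih =>
    simp only [hits_concat, Finset.sum_add_distrib, ih, List.length_append, List.length_singleton,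
      slots_succ]
    congr 1
    by_cases h : (l.length + 1) % L = ℓ <;> simp [h]

theorem div_le_slots {L ℓ : ℕ} (hℓ : ℓ < L) (n : ℕ) : n / L ≤ slots L ℓ n := by
  have hL : 0 < L := by omega
  -- The residue ℓ - 1 is written ℓ + (L - 1) to avoid truncated subtraction at ℓ = 0.
  have h1 : slots L ℓ n = Nat.count (· ≡ ℓ + (L - 1) [MOD L]) n := by
    unfold slots
    congr 1
    funext i
    rw [eq_iff_iff]
    have : (i + 1) % L = ℓ ↔ i + 1 ≡ ℓ [MOD L] := by
      rw [Nat.ModEq, Nat.mod_eq_of_lt hℓ]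
    rw [this]
    constructor
    · intro h
      have h2 := h.add_right (L - 1)
      have h3 : i + 1 + (L - 1) = i + L := by omega
      rw [h3] at h2
      exact (Nat.add_modEq_right).symm.trans h2
    · intro h
      have h2 := h.add_right 1
      have h3 : ℓ + (L - 1) + 1 = ℓ + L := by omega
      rw [h3] at h2
      exact h2.trans Nat.add_modEq_right
  rw [h1, Nat.count_modEq_card _ hL]
  omega

theorem length_le_mul_slots {L ℓ : ℕ} (hℓ : ℓ < L) (n : ℕ) : n + 1 ≤ L * (slots L ℓ n + 1) := by
  have h1 := div_le_slots hℓ n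
  have h2 := Nat.lt_mul_div_succ n (show 0 < L by omega)
  calc n + 1 ≤ L * (n / L + 1) := h2
    _ ≤ _ := Nat.mul_le_mul_left _ (by omega)

theorem successors_concat (s : S) (a : A) (h : List (S × A × S)) (x : S × A × S) :
    successors s a (h ++ [x]) =
      successors s a h ++ if x.1 = s ∧ x.2.1 = a then [x.2.2] else [] := by
  simp only [successors, List.filterMap_append]
  split_ifs with h <;> simp [h]

theorem mem_successors {s : S} {a : A} {h : List (S × A × S)} {y : S}
    (hy : y ∈ successors s a h) : (s, a, y) ∈ h := by
  simp only [successors, List.mem_filterMap] at hy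
  obtain ⟨⟨x, b, z⟩, hx, h2⟩ := hy
  split_ifs at h2 with h3
  simp only [Option.some.injEq] at h2
  obtain ⟨rfl, rfl⟩ := h3
  rwa [← h2]

/-- Visit counts and datasets after processing the transitions `h`. -/
def recordAll (L : ℕ) (h : List (S × A × S)) : (S → A → ℕ) × (ℕ → Multiset (S × A × S)) :=
  h.foldl (record L) (fun _ _ => 0, fun _ => 0)

theorem recordAll_concat (L : ℕ) (h : List (S × A × S)) (x : S × A × S) :
    recordAll L (h ++ [x]) = record L (recordAll L h) x := by
  simp [recordAll]

theorem recordAll_fst (L : ℕ) (h : List (S × A × S)) (s : S) (a : A) :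
    (recordAll L h).1 s a = (successors s a h).length := by
  induction h using List.reverseRecOn with
  | nil => rfl
  | append_singleton h x ih =>
    rw [recordAll_concat, successors_concat]
    simp only [record, ih]
    by_cases h1 : x.1 = s ∧ x.2.1 = a
    · simp [h1]
    · have : ¬ (s = x.1 ∧ a = x.2.1) := fun h => h1 ⟨h.1.symm, h.2.symm⟩
      simp [h1, this]

/-- Together with the slot count below, this reduces the datasets to the ordered list of successors
of each pair, on which the probabilistic estimates are carried out. -/
theorem recordAll_count (L : ℕ) (h : List (S × A × S)) (ℓ : ℕ) (s : S) (a : A) (y : S) :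
    ((recordAll L h).2 ℓ).count (s, a, y) = hits L ℓ y (successors s a h) := by
  induction h using List.reverseRecOn with
  | nil => simp [recordAll, successors, hits_nil]
  | append_singleton h x ih =>
    obtain ⟨xs, xa, xy⟩ := x
    rw [recordAll_concat, successors_concat]
    simp only [record, recordAll_fst]
    by_cases h1 : xs = s ∧ xa = a
    · obtain ⟨rfl, rfl⟩ := h1
      simp only [and_self, if_true, hits_concat, ← ih]
      by_cases h2 : ℓ = ((successors xs xa h).length + 1) % L
      · rw [if_pos h2, Multiset.count_cons]
        simp [← h2, eq_comm]
      · rw [if_neg h2, if_neg (fun h => h2 h.1.symm), add_zero]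
    · have h3 : ¬ (s, a, y) = (xs, xa, xy) := by
        rintro ⟨⟩
        exact h1 ⟨rfl, rfl⟩
      simp only [h1, if_false, List.append_nil, ← ih]
      split_ifs
      · rw [Multiset.count_cons, if_neg h3, add_zero]
      · rfl

theorem recordAll_countP (L : ℕ) (h : List (S × A × S)) (ℓ : ℕ) (s : S) (a : A) :
    ((recordAll L h).2 ℓ).countP (fun x => x.1 = s ∧ x.2.1 = a) =
      slots L ℓ (successors s a h).length := by
  induction h using List.reverseRecOn with
  | nil => simp [recordAll, successors, slots]
  | append_singleton h x ih =>
    obtain ⟨xs, xa, xy⟩ := x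
    rw [recordAll_concat, successors_concat]
    simp only [record, recordAll_fst]
    by_cases h1 : xs = s ∧ xa = a
    · obtain ⟨rfl, rfl⟩ := h1
      simp only [and_self, if_true, List.length_append, List.length_singleton, slots_succ, ← ih]
      by_cases h2 : ℓ = ((successors xs xa h).length + 1) % L
      · rw [if_pos h2, Multiset.countP_cons]
        simp [← h2]
      · rw [if_neg h2, if_neg (fun h => h2 h.symm), add_zero]
    · simp only [h1, if_false, List.append_nil, ← ih]
      split_ifs
      · rw [Multiset.countP_cons, if_neg h1, add_zero]
      · rfl

theorem critic_recordAll [Fintype S] (L : ℕ) (h : List (S × A × S)) (ℓ : ℕ) (V : S → ℝ)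
    (s : S) (a : A) :
    critic ((recordAll L h).2 ℓ) V s a = (∑ y, (hits L ℓ y (successors s a h) : ℝ) * V y) /
      (slots L ℓ (successors s a h).length + 2) := by
  simp only [critic, estP, recordAll_count, recordAll_countP, Finset.sum_div]
  exact Finset.sum_congr rfl fun y _ => by ring

theorem critic_mem_Icc [Fintype S] (R : Multiset (S × A × S)) {V : S → ℝ} {b : ℝ}
    (hb : 0 ≤ b) (hV : ∀ s, V s ∈ Set.Icc 0 b) (L : ℕ) (h : List (S × A × S)) (ℓ : ℕ)
    (hR : R = (recordAll L h).2 ℓ) (s : S) (a : A) : critic R V s a ∈ Set.Icc 0 b := by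
  rw [hR, critic_recordAll]
  constructor
  · exact div_nonneg (Finset.sum_nonneg fun y _ => mul_nonneg (by positivity) (hV y).1)
      (by positivity)
  · rw [div_le_iff₀ (by positivity)]
    calc _ ≤ ∑ y, (hits L ℓ y (successors s a h) : ℝ) * b :=
          Finset.sum_le_sum fun y _ => mul_le_mul_of_nonneg_left (hV y).2 (by positivity)
      _ = b * slots L ℓ (successors s a h).length := by
          rw [← Finset.sum_mul, ← Nat.cast_sum, sum_hits, mul_comm]
      _ ≤ _ := mul_le_mul_of_nonneg_left (by linarith) hb

end Counts

/-! ### The two aggregation rules -/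

section Aggregate
variable {L : ℕ}

theorem aggregate_nonneg (rule : Rule) {x : Fin L → ℝ} (hx : ∀ ℓ, 0 ≤ x ℓ) :
    0 ≤ aggregate rule x := by
  cases rule with
  | min => exact Real.iInf_nonneg hx
  | meanStd => exact le_max_right _ _

/-- For mean minus deviation this works because the deviation is the unnormalized ℓ² norm, which
dominates each single |xℓ - mean|. Hence one optimistic critic is enough under either rule. -/
theorem aggregate_le (rule : Rule) {x : Fin L → ℝ} (hx : ∀ ℓ, 0 ≤ x ℓ) (ℓ : Fin L) :
    aggregate rule x ≤ x ℓ := by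
  cases rule with
  | min => exact ciInf_le ⟨0, by rintro _ ⟨i, rfl⟩; exact hx i⟩ ℓ
  | meanStd =>
    refine max_le ?_ (hx ℓ)
    have h1 : (x ℓ - (∑ ℓ', x ℓ') / L) ^ 2 ≤ ∑ ℓ, (x ℓ - (∑ ℓ', x ℓ') / L) ^ 2 :=
      Finset.single_le_sum (f := fun ℓ => (x ℓ - (∑ ℓ', x ℓ') / L) ^ 2)
        (fun i _ => sq_nonneg _) (Finset.mem_univ ℓ)
    have h2 := Real.abs_le_sqrt h1
    have h3 := neg_abs_le (x ℓ - (∑ ℓ', x ℓ') / L)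
    linarith

/-- The mean is off by at most e and the deviation is at most √L·2e ≤ 2Le; the minimum loses only e.
The bound 3Le covers both. -/
theorem le_aggregate (rule : Rule) (hL : 0 < L) {x : Fin L → ℝ} {y e : ℝ}
    (hx : ∀ ℓ, |x ℓ - y| ≤ e) : y - 3 * L * e ≤ aggregate rule x := by
  have : Nonempty (Fin L) := ⟨⟨0, hL⟩⟩
  have he : 0 ≤ e := (abs_nonneg _).trans (hx ⟨0, hL⟩)
  have hL1 : (1 : ℝ) ≤ L := by exact_mod_cast hL
  have hLe : e ≤ L * e := le_mul_of_one_le_left he hL1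
  cases rule with
  | min =>
    refine le_ciInf fun ℓ => ?_
    have := (abs_le.1 (hx ℓ)).1
    linarith
  | meanStd =>
    refine le_max_of_le_left ?_
    have hmean : |(∑ ℓ', x ℓ') / L - y| ≤ e := by
      have h1 : (∑ ℓ', x ℓ') / L - y = (∑ ℓ', (x ℓ' - y)) / L := by
        rw [Finset.sum_sub_distrib]
        simp
        field_simp
      rw [h1, abs_div, Nat.abs_cast, div_le_iff₀ (by positivity)]
      refine (Finset.abs_sum_le_sum_abs _ _).trans ?_
      refine (Finset.sum_le_sum fun ℓ _ => hx ℓ).trans_eq ?_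
      simp [mul_comm]
    have hstd : Real.sqrt (∑ ℓ, (x ℓ - (∑ ℓ', x ℓ') / L) ^ 2) ≤ 2 * L * e := by
      rw [Real.sqrt_le_left (by positivity)]
      calc _ ≤ ∑ _ℓ : Fin L, (2 * e) ^ 2 := by
            refine Finset.sum_le_sum fun ℓ _ => ?_
            rw [sq_le_sq, abs_of_nonneg (show 0 ≤ 2 * e by positivity)]
            have h1 := hx ℓ
            rw [abs_le] at h1 hmean ⊢
            constructor <;> linarith
        _ = L * (2 * e) ^ 2 := by simp
        _ ≤ (2 * L * e) ^ 2 := by nlinarith [sq_nonneg (2 * e), sq_nonneg e]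
    have := (abs_le.1 hmean).1
    linarith

end Aggregate

/-! ### Critics under two-point transition laws -/

section TwoPoint
variable {S : Type u} {A : Type v} [Fintype S]

/-- The two states may coincide; then the transition is deterministic and the formulas below still
hold. -/
theorem exists_ordered_support {M : MDP S A} (hM : M.IsBinarized) (V : S → ℝ) (s : S) (a : A) :
    ∃ y z, V z ≤ V y ∧ ∀ x, M.P s a x ≠ 0 → x = y ∨ x = z := by
  have h1 : ∃ y z, (M.P s a).support ⊆ {y, z} := by
    obtain ⟨y, hy⟩ := (M.P s a).support_nonempty
    by_cases h : (M.P s a).support ⊆ {y}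
    · exact ⟨y, y, by simpa using h⟩
    · obtain ⟨z, hz, hzy⟩ := Set.not_subset.1 h
      refine ⟨y, z, ?_⟩
      have h2 : ({y, z} : Set S) ⊆ (M.P s a).support := by
        rintro x (rfl | rfl) <;> assumption
      have h3 : ({y, z} : Set S).encard = 2 := Set.encard_pair (Ne.symm hzy)
      exact ((Set.toFinite _).eq_of_subset_of_encard_le h2 ((hM s a).trans h3.ge)).ge
  obtain ⟨y, z, h⟩ := h1
  rcases le_total (V z) (V y) with h2 | h2
  · exact ⟨y, z, h2, fun x hx => h hx⟩
  · exact ⟨z, y, h2, fun x hx => (h hx).symm⟩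

theorem sum_mul_two_point (w V : S → ℝ) (y z : S) (hw : ∀ x, w x ≠ 0 → x = y ∨ x = z) :
    ∑ x, w x * V x = (∑ x, w x) * V z + w y * (V y - V z) := by
  have h1 : ∑ x, w x * (V x - V z) = w y * (V y - V z) := by
    refine Finset.sum_eq_single y (fun x _ hx => ?_) (by simp)
    by_cases h : w x = 0
    · simp [h]
    · rw [(hw x h).resolve_left hx]; simp
  rw [← h1, Finset.sum_mul, ← Finset.sum_add_distrib]
  exact Finset.sum_congr rfl fun x _ => by ring

theorem next_two_point (M : MDP S A) (V : S → ℝ) (s : S) (a : A) {y z : S}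
    (hsupp : ∀ x, M.P s a x ≠ 0 → x = y ∨ x = z) :
    M.next V s a = V z + (M.P s a y).toReal * (V y - V z) := by
  rw [MDP.next, sum_mul_two_point _ V y z, sum_toReal, one_mul]
  intro x hx
  exact hsupp x fun h0 => hx (by simp [h0])

variable [DecidableEq S] [DecidableEq A]

/-- The critic of a dataset whose successors lie in the support of the transition law. -/
theorem critic_two_point {M : MDP S A} (L : ℕ) (h : List (S × A × S)) (ℓ : ℕ) (V : S → ℝ)
    (s : S) (a : A) {y z : S} (hsupp : ∀ x, M.P s a x ≠ 0 → x = y ∨ x = z)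
    (hh : ∀ x ∈ h, M.P x.1 x.2.1 x.2.2 ≠ 0) :
    critic ((recordAll L h).2 ℓ) V s a =
      (slots L ℓ (successors s a h).length * V z +
        hits L ℓ y (successors s a h) * (V y - V z)) /
      (slots L ℓ (successors s a h).length + 2) := by
  rw [critic_recordAll, sum_mul_two_point _ V y z, ← Nat.cast_sum, sum_hits]
  intro x hx
  refine hsupp x fun h0 => hx ?_
  rw [hits_eq_zero, Nat.cast_zero]
  intro hmem
  exact hh _ (mem_successors hmem) h0

/-- The two phantom visits in the denominator carry value 0. They leave room for p(n+2) hits of the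
better successor, slightly more than the mean pn. -/
theorem critic_le_next {M : MDP S A} (L : ℕ) (h : List (S × A × S)) (ℓ : ℕ) (V : S → ℝ)
    (hV : ∀ s, 0 ≤ V s) (s : S) (a : A) {y z : S} (hyz : V z ≤ V y)
    (hsupp : ∀ x, M.P s a x ≠ 0 → x = y ∨ x = z) (hh : ∀ x ∈ h, M.P x.1 x.2.1 x.2.2 ≠ 0)
    (hhits : (hits L ℓ y (successors s a h) : ℝ) ≤
      (M.P s a y).toReal * (slots L ℓ (successors s a h).length + 2)) :
    critic ((recordAll L h).2 ℓ) V s a ≤ M.next V s a := by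
  rw [critic_two_point L h ℓ V s a hsupp hh, next_two_point M V s a hsupp,
    div_le_iff₀ (by positivity)]
  have h1 := mul_le_mul_of_nonneg_right hhits (sub_nonneg.2 hyz)
  have h2 := hV z
  linarith

theorem abs_critic_sub_next_le {M : MDP S A} (L : ℕ) (h : List (S × A × S)) (ℓ : ℕ) {V : S → ℝ}
    {b ι : ℝ} (hV : ∀ s, V s ∈ Set.Icc 0 b) (s : S) (a : A) {y z : S}
    (hyz : V z ≤ V y) (hsupp : ∀ x, M.P s a x ≠ 0 → x = y ∨ x = z)
    (hh : ∀ x ∈ h, M.P x.1 x.2.1 x.2.2 ≠ 0)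
    (hhits : ((hits L ℓ y (successors s a h) : ℝ) -
      (M.P s a y).toReal * slots L ℓ (successors s a h).length) ^ 2 ≤
        4 * slots L ℓ (successors s a h).length * ι) :
    |critic ((recordAll L h).2 ℓ) V s a - M.next V s a| ≤
      b * (4 + 2 * Real.sqrt ι) / Real.sqrt (slots L ℓ (successors s a h).length + 1) := by
  rw [critic_two_point L h ℓ V s a hsupp hh, next_two_point M V s a hsupp]
  set n : ℝ := (slots L ℓ (successors s a h).length : ℝ) with hn
  set m : ℝ := (hits L ℓ y (successors s a h) : ℝ)
  set p := (M.P s a y).toReal with hp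
  have hp0 : 0 ≤ p := ENNReal.toReal_nonneg
  have hp1 : p ≤ 1 := ENNReal.toReal_le_of_le_ofReal zero_le_one (by simpa using PMF.coe_le_one _ _)
  have hn0 : 0 ≤ n := by positivity
  have h1 : |m - p * n| ≤ 2 * Real.sqrt n * Real.sqrt ι := by
    refine (Real.abs_le_sqrt hhits).trans_eq ?_
    rw [Real.sqrt_mul (by positivity), Real.sqrt_mul (by norm_num),
      show (4 : ℝ) = 2 ^ 2 by norm_num, Real.sqrt_sq (by norm_num)]
  set r := Real.sqrt (n + 1) with hr
  have hr2 : r * r = n + 1 := Real.mul_self_sqrt (by positivity)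
  have hr1 : 1 ≤ r := Real.one_le_sqrt.2 (by linarith)
  have hnr : Real.sqrt n ≤ r := Real.sqrt_le_sqrt (by linarith)
  have hι0 := Real.sqrt_nonneg ι
  have hz := hV z
  have hy := hV y
  have hb : 0 ≤ b := hz.1.trans hz.2
  -- Splits the error into sampling noise m - pn and the bias of the two phantom visits.
  have h2 : (n * V z + m * (V y - V z)) / (n + 2) - (V z + p * (V y - V z)) =
      ((V y - V z) * (m - p * n - 2 * p) - 2 * V z) / (n + 2) := by
    field_simp
    ring
  have h3 : |(V y - V z) * (m - p * n - 2 * p) - 2 * V z| ≤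
      b * (2 * Real.sqrt n * Real.sqrt ι + 2) + 2 * b := by
    refine (abs_sub _ _).trans (add_le_add ?_ ?_)
    · rw [abs_mul]
      refine mul_le_mul ?_ ?_ (abs_nonneg _) hb
      · rw [abs_of_nonneg (by linarith)]; linarith [hy.2, hz.1]
      · refine (abs_sub _ _).trans (add_le_add h1 ?_)
        rw [abs_of_nonneg (by positivity)]; linarith
    · rw [abs_of_nonneg (by linarith [hz.1])]; linarith [hz.2]
  rw [h2, abs_div, abs_of_pos (show 0 < n + 2 by positivity), div_le_div_iff₀ (by positivity)
    (by positivity)]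
  calc _ ≤ (b * (2 * Real.sqrt n * Real.sqrt ι + 2) + 2 * b) * r :=
        mul_le_mul_of_nonneg_right h3 (by positivity)
    _ ≤ (b * (2 * r * Real.sqrt ι + 2) + 2 * b) * r := by gcongr
    _ ≤ b * (4 + 2 * Real.sqrt ι) * (r * r) := by
        have : 0 ≤ b * (r - 1) * r := by
          have : 0 ≤ r - 1 := by linarith
          positivity
        nlinarith
    _ ≤ _ := by
        rw [hr2]
        exact mul_le_mul_of_nonneg_left (by linarith) (by positivity)

end TwoPoint
-- Recursion and range of the algorithm's iterates
section Run
variable {S : Type u} {A : Type v} [Fintype S] [DecidableEq S] [Fintype A] [Nonempty A]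
  [DecidableEq A]

theorem run_concat (γ : ℝ) (I : Input S A) (τs : List (List (S × A × S))) (τ : List (S × A × S)) :
    run γ I (τs ++ [τ]) = step γ I (run γ I τs) τ := by
  simp [run]

theorem run_counts (γ : ℝ) (I : Input S A) (τs : List (List (S × A × S))) :
    ((run γ I τs).N, (run γ I τs).R) = recordAll I.L τs.flatten := by
  induction τs using List.reverseRecOn with
  | nil => rfl
  | append_singleton τs τ ih =>
    rw [run_concat, List.flatten_append, recordAll, List.foldl_append, ← recordAll, ← ih]
    simp [step]

theorem run_R (γ : ℝ) (I : Input S A) (τs : List (List (S × A × S))) :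
    (run γ I τs).R = (recordAll I.L τs.flatten).2 := by
  rw [← run_counts γ]

/-- The optimistic state-action value estimate computed in the last iteration. -/
noncomputable def runQ (γ : ℝ) (I : Input S A) (τs : List (List (S × A × S)))
    (τ : List (S × A × S)) : S → A → ℝ :=
  optimisticQ γ I.L I.rule (run γ I (τs ++ [τ])).R (run γ I τs).V (run γ I (τs ++ [τ])).c

theorem run_policy_concat (γ : ℝ) (I : Input S A) (τs : List (List (S × A × S)))
    (τ : List (S × A × S)) (s : S) :
    (run γ I (τs ++ [τ])).policy s = mwUpdate I.η ((run γ I τs).policy s) (runQ γ I τs τ s) := by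
  simp only [runQ, run_concat]
  rfl

theorem run_V_concat (γ : ℝ) (I : Input S A) (τs : List (List (S × A × S)))
    (τ : List (S × A × S)) (s : S) :
    (run γ I (τs ++ [τ])).V s =
      ∑ a, ((run γ I (τs ++ [τ])).policy s a).toReal * runQ γ I τs τ s a := by
  simp only [runQ, run_concat]
  rfl

theorem run_c_mem_Icc (γ : ℝ) (I : Input S A) (hc : ∀ s a, I.c₀ s a ∈ Set.Icc (0 : ℝ) 1)
    (τs : List (List (S × A × S))) (s : S) (a : A) : (run γ I τs).c s a ∈ Set.Icc (0 : ℝ) 1 := by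
  induction τs using List.reverseRecOn with
  | nil => exact hc s a
  | append_singleton τs τ _ =>
    rw [run_concat]
    exact ⟨le_max_left _ _, max_le zero_le_one (min_le_left _ _)⟩

/-- The bound 1/(1-γ) is the fixed point of x ↦ 1 + γx, and neither the critics nor the aggregation
exceed the range of V. -/
theorem runQ_mem_Icc {γ : ℝ} (hγ : 0 ≤ γ) (hγ1 : γ < 1) (I : Input S A) (hL : 0 < I.L)
    (hc : ∀ s a, I.c₀ s a ∈ Set.Icc (0 : ℝ) 1) (τs : List (List (S × A × S)))
    (hV : ∀ s, (run γ I τs).V s ∈ Set.Icc (0 : ℝ) (1 / (1 - γ))) (τ : List (S × A × S))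
    (s : S) (a : A) : runQ γ I τs τ s a ∈ Set.Icc (0 : ℝ) (1 / (1 - γ)) := by
  have hB : 0 ≤ 1 / (1 - γ) := by
    have : 0 < 1 - γ := by linarith
    positivity
  have h1 : ∀ ℓ : Fin I.L, critic ((run γ I (τs ++ [τ])).R ℓ) (run γ I τs).V s a ∈
      Set.Icc (0 : ℝ) (1 / (1 - γ)) := fun ℓ =>
    critic_mem_Icc _ hB hV I.L (τs ++ [τ]).flatten ℓ (by rw [run_R]) s a
  have h2 := aggregate_nonneg I.rule fun ℓ => (h1 ℓ).1
  have h3 := (aggregate_le I.rule (fun ℓ => (h1 ℓ).1) ⟨0, hL⟩).trans (h1 ⟨0, hL⟩).2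
  have h4 := run_c_mem_Icc γ I hc (τs ++ [τ]) s a
  simp only [runQ, optimisticQ]
  constructor
  · exact add_nonneg h4.1 (mul_nonneg hγ h2)
  · have h5 : 1 + γ * (1 / (1 - γ)) = 1 / (1 - γ) := by
      have : 1 - γ ≠ 0 := by linarith
      field_simp
      ring
    rw [← h5]
    exact add_le_add h4.2 (mul_le_mul_of_nonneg_left h3 hγ)

theorem run_V_mem_Icc {γ : ℝ} (hγ : 0 ≤ γ) (hγ1 : γ < 1) (I : Input S A) (hL : 0 < I.L)
    (hc : ∀ s a, I.c₀ s a ∈ Set.Icc (0 : ℝ) 1)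
    (hV : ∀ s, I.V₁ s ∈ Set.Icc (0 : ℝ) (1 / (1 - γ))) (τs : List (List (S × A × S))) (s : S) :
    (run γ I τs).V s ∈ Set.Icc (0 : ℝ) (1 / (1 - γ)) := by
  induction τs using List.reverseRecOn generalizing s with
  | nil => exact hV s
  | append_singleton τs τ ih =>
    rw [run_V_concat]
    exact sum_toReal_mul_mem_Icc _ fun a => runQ_mem_Icc hγ hγ1 I hL hc τs ih τ s a

end Run

/-! ### Binomial estimates -/

/-- Expectation of `f (m + X)` for `X` binomial with parameters `r` and `p`. -/
noncomputable def binE (p : ℝ) (f : ℕ → ℝ) : ℕ → ℕ → ℝ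
  | 0, m => f m
  | r + 1, m => p * binE p f r (m + 1) + (1 - p) * binE p f r m

theorem binE_mono {p : ℝ} (h0 : 0 ≤ p) (h1 : p ≤ 1) {f g : ℕ → ℝ} (h : ∀ m, f m ≤ g m)
    (r m : ℕ) : binE p f r m ≤ binE p g r m := by
  induction r generalizing m with
  | zero => exact h m
  | succ r ih =>
    exact add_le_add (mul_le_mul_of_nonneg_left (ih _) h0)
      (mul_le_mul_of_nonneg_left (ih _) (by linarith))

theorem binE_const (p c : ℝ) (r m : ℕ) : binE p (fun _ => c) r m = c := by
  induction r generalizing m with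
  | zero => rfl
  | succ r ih => simp only [binE, ih]; ring

theorem binE_nonneg {p : ℝ} (h0 : 0 ≤ p) (h1 : p ≤ 1) {f : ℕ → ℝ} (h : ∀ m, 0 ≤ f m) (r m : ℕ) :
    0 ≤ binE p f r m := by
  rw [← binE_const p 0 r m]
  exact binE_mono h0 h1 h r m

theorem binE_add (p : ℝ) (f g : ℕ → ℝ) (r m : ℕ) :
    binE p (fun m => f m + g m) r m = binE p f r m + binE p g r m := by
  induction r generalizing m with
  | zero => rfl
  | succ r ih => simp only [binE, ih]; ring

/-- Central moments of the binomial law, packaged for quartics without cubic term. The general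
offset m - c lets the recursion close under induction. -/
theorem binE_quartic (p c e a b d : ℝ) (r m : ℕ) :
    binE p (fun m => e + a * (m - c) + b * (m - c) ^ 2 + d * (m - c) ^ 4) r m =
      e + a * (m - c + p * r) + b * ((m - c + p * r) ^ 2 + r * (p * (1 - p))) +
      d * ((m - c + p * r) ^ 4 + 6 * (m - c + p * r) ^ 2 * (r * (p * (1 - p))) +
        4 * (m - c + p * r) * (r * (p * (1 - p) * (1 - 2 * p))) +
        r * (p * (1 - p) * (1 - 3 * (p * (1 - p)))) + 3 * r * (r - 1) * (p * (1 - p)) ^ 2) := by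
  induction r generalizing m with
  | zero => simp [binE]
  | succ r ih =>
    simp only [binE, ih]
    push_cast
    ring

theorem binE_ne_zero (p : ℝ) (r m : ℕ) :
    binE p (fun m => if m = 0 then 0 else 1) r m = if m = 0 then 1 - (1 - p) ^ r else 1 := by
  induction r generalizing m with
  | zero => simp [binE]
  | succ r ih =>
    simp only [binE, ih]
    by_cases h : m = 0
    · simp only [h]; simp; ring
    · simp [h]

theorem binE_exp (p t c : ℝ) (r m : ℕ) :
    binE p (fun m => Real.exp (t * m - c)) r m =
      Real.exp (t * m - c + t * p * r) *
        (p * Real.exp (t * (1 - p)) + (1 - p) * Real.exp (-(t * p))) ^ r := by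
  induction r generalizing m with
  | zero => simp [binE]
  | succ r ih =>
    simp only [binE, ih]
    have h1 : Real.exp (t * ((m + 1 : ℕ) : ℝ) - c + t * p * r) =
        Real.exp (t * m - c + t * p * (r + 1 : ℕ)) * Real.exp (t * (1 - p)) := by
      rw [← Real.exp_add]; congr 1; push_cast; ring
    have h2 : Real.exp (t * m - c + t * p * r) =
        Real.exp (t * m - c + t * p * (r + 1 : ℕ)) * Real.exp (-(t * p)) := by
      rw [← Real.exp_add]; congr 1; push_cast; ring
    rw [h1, h2, pow_succ]
    ring

/-- For |t| ≤ 1 use exp x ≤ 1 + x + x², where the linear terms cancel. For |t| ≥ 1 both exponents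
are at most |t| ≤ t². -/
theorem two_point_mgf_le {p : ℝ} (h0 : 0 ≤ p) (h1 : p ≤ 1) (t : ℝ) :
    p * Real.exp (t * (1 - p)) + (1 - p) * Real.exp (-(t * p)) ≤ Real.exp (t ^ 2) := by
  have hq : 0 ≤ 1 - p := by linarith
  have ha1 : |t * (1 - p)| ≤ |t| := by
    rw [abs_mul, abs_of_nonneg hq]; exact mul_le_of_le_one_right (abs_nonneg _) (by linarith)
  have ha2 : |-(t * p)| ≤ |t| := by
    rw [abs_neg, abs_mul, abs_of_nonneg h0]; exact mul_le_of_le_one_right (abs_nonneg _) h1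
  rcases le_total |t| 1 with h | h
  · have e1 := (abs_le.1 (Real.abs_exp_sub_one_sub_id_le (ha1.trans h))).2
    have e2 := (abs_le.1 (Real.abs_exp_sub_one_sub_id_le (ha2.trans h))).2
    have e3 := Real.add_one_le_exp (t ^ 2)
    have f1 := mul_le_mul_of_nonneg_left e1 h0
    have f2 := mul_le_mul_of_nonneg_left e2 hq
    have f3 : p * (1 - p) * t ^ 2 ≤ 1 * t ^ 2 :=
      mul_le_mul_of_nonneg_right (by nlinarith) (sq_nonneg t)
    nlinarith
  · have hle : ∀ x, |x| ≤ |t| → Real.exp x ≤ Real.exp (t ^ 2) := by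
      intro x hx
      rw [Real.exp_le_exp, ← sq_abs]
      have := le_abs_self x
      nlinarith
    have f1 := mul_le_mul_of_nonneg_left (hle _ ha1) h0
    have f2 := mul_le_mul_of_nonneg_left (hle _ ha2) hq
    linarith

theorem binE_deviation_le {p : ℝ} (h0 : 0 ≤ p) (h1 : p ≤ 1) (r : ℕ) {ι : ℝ} (hι : 0 ≤ ι) :
    binE p (fun m => if 4 * r * ι < (m - p * r) ^ 2 then 1 else 0) r 0 ≤
      2 * Real.exp (-ι) := by
  rcases Nat.eq_zero_or_pos r with rfl | hr
  · simp [binE]; positivity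
  have hr' : (0 : ℝ) < r := by exact_mod_cast hr
  -- Chernoff's choice: a deviation 2√(rι) contributes 2ι to the exponent and the moment generating
  -- function gives back at most rt² = ι, so each tail is at most exp(-ι).
  set t := Real.sqrt (ι / r) with ht
  have ht0 : 0 ≤ t := Real.sqrt_nonneg _
  have ht2 : t ^ 2 = ι / r := Real.sq_sqrt (by positivity)
  have hb : ∀ t : ℝ, t ^ 2 = ι / r →
      binE p (fun m => Real.exp (t * m - (t * p * r + 2 * ι))) r 0 ≤ Real.exp (-ι) := by
    intro t ht
    rw [binE_exp]
    have e1 := pow_le_pow_left₀ (add_nonneg (mul_nonneg h0 (Real.exp_pos (t * (1 - p))).le)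
      (mul_nonneg (sub_nonneg.2 h1) (Real.exp_pos (-(t * p))).le)) (two_point_mgf_le h0 h1 t) r
    refine (mul_le_mul_of_nonneg_left e1 (Real.exp_pos _).le).trans_eq ?_
    rw [← Real.exp_nat_mul, ← Real.exp_add, ht]
    congr 1
    field_simp
    push_cast
    ring
  calc _ ≤ binE p (fun m => Real.exp (t * m - (t * p * r + 2 * ι)) +
          Real.exp (-t * m - (-t * p * r + 2 * ι))) r 0 := by
        refine binE_mono h0 h1 (fun m => ?_) r 0
        split_ifs with h
        · have h2 : 2 * ι ≤ t * |m - p * r| := by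
            refine le_of_sq_le_sq ?_ (by positivity)
            rw [mul_pow t, sq_abs, ht2]
            have := mul_le_mul_of_nonneg_left h.le (show 0 ≤ ι / r by positivity)
            refine le_trans (le_of_eq ?_) this
            field_simp
            ring
          rcases abs_cases ((m : ℝ) - p * r) with ⟨h3, -⟩ | ⟨h3, -⟩
          · rw [h3] at h2
            have := Real.one_le_exp (show 0 ≤ t * m - (t * p * r + 2 * ι) by linarith)
            have := Real.exp_pos (-t * m - (-t * p * r + 2 * ι))
            linarith
          · rw [h3] at h2
            have := Real.one_le_exp (show 0 ≤ -t * m - (-t * p * r + 2 * ι) by linarith)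
            have := Real.exp_pos (t * m - (t * p * r + 2 * ι))
            linarith
        · positivity
    _ ≤ 2 * Real.exp (-ι) := by
        rw [binE_add]
        have := hb t ht2
        have := hb (-t) (by rw [neg_sq, ht2])
        linarith

/-- With constant probability, the number of successes is small enough for optimism. -/
theorem binE_optimism_le {p : ℝ} (h0 : 0 ≤ p) (h1 : p ≤ 1) (r : ℕ) :
    binE p (fun m => if p * (r + 2) < m then 1 else 0) r 0 ≤ 11 / 12 := by
  set v : ℝ := r * (p * (1 - p)) with hv
  have hpq : 0 ≤ p * (1 - p) := mul_nonneg h0 (by linarith)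
  have hv0 : 0 ≤ v := by positivity
  rcases le_or_gt (1 / 2) v with hv1 | hv1
  -- Large variance: the quartic 1 + (10/27)w - (5/9)w² + (5/27)w⁴ is nonnegative and exceeds 1 by
  -- (5/27)w(w-1)²(w+2) for w ≥ 0. The fourth moment is at most (3 + 1/v)v² ≤ 5v², and with the
  -- value 5v² the choice T² = 10v/3 minimizes the expectation, which is then 11/12.
  · set T := Real.sqrt (10 * v / 3) with hT
    have hT2 : T ^ 2 = 10 * v / 3 := Real.sq_sqrt (by positivity)
    have hT0 : 0 < T := Real.sqrt_pos.2 (by positivity)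
    calc _ ≤ binE p (fun m => 1 + 10 / (27 * T) * (m - p * r) + (-(5 / (9 * T ^ 2))) *
            (m - p * r) ^ 2 + 5 / (27 * T ^ 4) * (m - p * r) ^ 4) r 0 := by
          refine binE_mono h0 h1 (fun m => ?_) r 0
          set w := ((m : ℝ) - p * r) / T with hw
          have hy : (m : ℝ) - p * r = w * T := by rw [hw]; field_simp
          have e1 : 1 + 10 / (27 * T) * ((m : ℝ) - p * r) + (-(5 / (9 * T ^ 2))) *
              (m - p * r) ^ 2 + 5 / (27 * T ^ 4) * (m - p * r) ^ 4 =
              1 + 10 / 27 * w - 5 / 9 * w ^ 2 + 5 / 27 * w ^ 4 := by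
            rw [hy]; field_simp; ring
          rw [e1]
          split_ifs with h
          · have hw0 : 0 ≤ w := div_nonneg (by nlinarith) hT0.le
            nlinarith [mul_nonneg hw0 (mul_nonneg (sq_nonneg (w - 1)) (show 0 ≤ w + 2 by linarith))]
          · nlinarith [sq_nonneg (w ^ 2 - 19 / 10), sq_nonneg (w + 5 / 4)]
      _ ≤ 11 / 12 := by
          rw [binE_quartic]
          have hT4 : T ^ 4 = (10 * v / 3) ^ 2 := by rw [← hT2]; ring
          have e2 : (r : ℝ) * (p * (1 - p) * (1 - 3 * (p * (1 - p)))) +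
              3 * r * (r - 1) * (p * (1 - p)) ^ 2 = v + 3 * v ^ 2 - 6 * v * (p * (1 - p)) := by
            rw [hv]; ring
          have e3 : ((0 : ℕ) : ℝ) - p * r + p * r = 0 := by push_cast; ring
          simp only [e3]
          rw [← hv, hT2, hT4]
          have e4 : 1 + 10 / (27 * T) * 0 + (-(5 / (9 * (10 * v / 3)))) * (0 ^ 2 + v) +
              5 / (27 * (10 * v / 3) ^ 2) * (0 ^ 4 + 6 * 0 ^ 2 * v +
              4 * 0 * (r * (p * (1 - p) * (1 - 2 * p))) +
              r * (p * (1 - p) * (1 - 3 * (p * (1 - p)))) +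
              3 * r * (r - 1) * (p * (1 - p)) ^ 2) =
              5 / 6 + (v + 3 * v ^ 2 - 6 * v * (p * (1 - p))) / (60 * v ^ 2) := by
            rw [← e2]
            have : v ≠ 0 := by positivity
            field_simp
            ring
          rw [e4]
          have e5 : (v + 3 * v ^ 2 - 6 * v * (p * (1 - p))) / (60 * v ^ 2) ≤ 1 / 12 := by
            rw [div_le_iff₀ (by positivity)]
            nlinarith [mul_nonneg hv0 hpq]
          linarith
  · rcases le_or_gt (1 / 2) p with hp | hp
    -- Here 2p ≥ 1, so failure forces m - pr > 1. Chebyshev's inequality bounds it by the variance v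
    -- < 1/2; this case uses the phantom visits.
    · calc _ ≤ binE p (fun m => 0 + 0 * (m - p * r) + 1 * (m - p * r) ^ 2 +
            0 * (m - p * r) ^ 4) r 0 := by
            refine binE_mono h0 h1 (fun m => ?_) r 0
            split_ifs with h
            · nlinarith
            · nlinarith [sq_nonneg ((m : ℝ) - p * r)]
        _ ≤ 11 / 12 := by
            rw [binE_quartic]
            have e3 : ((0 : ℕ) : ℝ) - p * r + p * r = 0 := by push_cast; ring
            simp only [e3]
            linarith
    -- Having no hit at all is never a failure. Its probability (1-p)^r is at least exp(-rp/(1-p)) ≥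
    -- exp(-2) ≥ 1/12, because rp/(1-p) = v/(1-p)² and 1-p > 1/2.
    · calc _ ≤ binE p (fun m => if m = 0 then 0 else 1) r 0 := by
            refine binE_mono h0 h1 (fun m => ?_) r 0
            by_cases hm : m = 0
            · have : ¬ p * ((r : ℝ) + 2) < 0 := not_lt.2 (by positivity)
              simp [hm, this]
            · simp only [hm, if_false]
              split_ifs <;> norm_num
        _ ≤ 11 / 12 := by
            rw [binE_ne_zero, if_pos rfl]
            have hq : 0 < 1 - p := by linarith
            have e1 := Real.one_sub_inv_le_log_of_pos hq
            have e2 : -2 ≤ r * Real.log (1 - p) := by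
              have e3 := mul_le_mul_of_nonneg_left e1 (Nat.cast_nonneg (α := ℝ) r)
              refine le_trans ?_ e3
              have e4 : (r : ℝ) * (1 - (1 - p)⁻¹) = -(v / (1 - p) ^ 2) := by
                rw [hv]; field_simp; ring
              rw [e4, neg_le_neg_iff, div_le_iff₀ (by positivity)]
              nlinarith
            have e5 : (1 - p) ^ r = Real.exp (r * Real.log (1 - p)) := by
              rw [Real.exp_nat_mul, Real.exp_log hq]
            have e6 : Real.exp (-2) ≤ (1 - p) ^ r := by
              rw [e5]; exact Real.exp_le_exp.2 e2
            have e7 : (1 / 12 : ℝ) ≤ Real.exp (-2) := by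
              rw [Real.exp_neg, one_div]
              refine inv_anti₀ (Real.exp_pos _) ?_
              have := Real.exp_one_lt_d9
              have e8 : Real.exp 2 = Real.exp 1 ^ 2 := by rw [← Real.exp_nat_mul]; norm_num
              rw [e8]
              nlinarith [Real.exp_pos 1]
            linarith

/-! ### The product potential over datasets -/

section Potential
variable {S : Type u} {A : Type v} [DecidableEq S] [DecidableEq A]

/-- Conditional expectation of `∏ ℓ, f ℓ (hits ℓ)` after `n` visits, given the successors `l` of the
first visits. -/
noncomputable def visitPotential (p : ℝ) (y : S) (L n : ℕ) (f : ℕ → ℕ → ℝ) (l : List S) : ℝ≥0∞ :=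
  ∏ ℓ ∈ Finset.range L,
    ENNReal.ofReal (binE p (f ℓ) (slots L ℓ n - slots L ℓ l.length) (hits L ℓ y l))

/-- A visit feeds exactly one dataset, so one factor reveals one Bernoulli draw and the others stay
fixed. The defining recursion of `binE` is then the martingale identity. -/
theorem expect_visitPotential (ρ : PMF S) (y : S) {L n : ℕ} (hL : 0 < L) {f : ℕ → ℕ → ℝ}
    (hf : ∀ ℓ m, 0 ≤ f ℓ m) (l : List S) (hl : l.length < n) :
    expect ρ (fun x => visitPotential (ρ y).toReal y L n f (l ++ [x])) =
      visitPotential (ρ y).toReal y L n f l := by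
  set p := (ρ y).toReal with hp
  have hp0 : 0 ≤ p := ENNReal.toReal_nonneg
  have hp1 : p ≤ 1 := ENNReal.toReal_le_of_le_ofReal zero_le_one (by simpa using PMF.coe_le_one _ _)
  set ℓ₀ := (l.length + 1) % L with hℓ₀
  have hmem : ℓ₀ ∈ Finset.range L := Finset.mem_range.2 (Nat.mod_lt _ hL)
  set m := hits L ℓ₀ y l with hm
  set r := slots L ℓ₀ n - slots L ℓ₀ (l.length + 1) with hr
  have hr1 : slots L ℓ₀ n - slots L ℓ₀ l.length = r + 1 := by
    have h1 := slots_mono L ℓ₀ (Nat.succ_le_of_lt hl)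
    have h2 : slots L ℓ₀ (l.length + 1) = slots L ℓ₀ l.length + 1 := by
      rw [slots_succ, if_pos hℓ₀.symm]
    simp only [Nat.succ_eq_add_one] at h1
    omega
  set C := ∏ ℓ ∈ (Finset.range L).erase ℓ₀,
    ENNReal.ofReal (binE p (f ℓ) (slots L ℓ n - slots L ℓ l.length) (hits L ℓ y l)) with hC
  have h1 : ∀ x, visitPotential p y L n f (l ++ [x]) =
      C * if x = y then ENNReal.ofReal (binE p (f ℓ₀) r (m + 1))
        else ENNReal.ofReal (binE p (f ℓ₀) r m) := by
    intro x
    rw [visitPotential, ← Finset.mul_prod_erase _ _ hmem, mul_comm]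
    congr 1
    · refine Finset.prod_congr rfl fun ℓ hℓ => ?_
      have hne : ¬ (l.length + 1) % L = ℓ := fun h => (Finset.ne_of_mem_erase hℓ) h.symm
      rw [hits_concat, if_neg (fun h => hne h.1), List.length_append, List.length_singleton,
        slots_succ, if_neg hne, add_zero, add_zero]
    · rw [hits_concat, List.length_append, List.length_singleton]
      by_cases h : x = y
      · simp [h, ← hℓ₀, ← hm, ← hr]
      · simp [h, ← hm, ← hr]
  have h2 : visitPotential p y L n f l = C * ENNReal.ofReal (binE p (f ℓ₀) (r + 1) m) := by
    rw [visitPotential, ← Finset.mul_prod_erase _ _ hmem, mul_comm, hr1]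
  have h3 : ρ y = ENNReal.ofReal p := (ENNReal.ofReal_toReal (ρ.apply_ne_top y)).symm
  simp only [h1]
  rw [expect_mul_left, expect_ite_eq, h2, h3, ← ENNReal.ofReal_one, ← ENNReal.ofReal_sub _ hp0,
    ← ENNReal.ofReal_mul hp0, ← ENNReal.ofReal_mul (sub_nonneg.2 hp1), ← ENNReal.ofReal_add]
  · rfl
  · exact mul_nonneg hp0 (binE_nonneg hp0 hp1 (hf ℓ₀) _ _)
  · exact mul_nonneg (sub_nonneg.2 hp1) (binE_nonneg hp0 hp1 (hf ℓ₀) _ _)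

/-- Truncating to the first n visits freezes the potential afterwards, and transitions from other
pairs do not touch it. -/
theorem expect_visitPotential_take (M : MDP S A) (s : S) (a : A) (y : S) {L : ℕ} (n : ℕ)
    (hL : 0 < L) {f : ℕ → ℕ → ℝ} (hf : ∀ ℓ m, 0 ≤ f ℓ m) (h : List (S × A × S)) (s' : S) (a' : A) :
    expect (M.P s' a') (fun x => visitPotential (M.P s a y).toReal y L n f
      ((successors s a (h ++ [(s', a', x)])).take n)) ≤
    visitPotential (M.P s a y).toReal y L n f ((successors s a h).take n) := by
  simp only [successors_concat]
  by_cases h1 : s' = s ∧ a' = a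
  · obtain ⟨rfl, rfl⟩ := h1
    simp only [and_self, if_true]
    rcases lt_or_ge (successors s' a' h).length n with h2 | h2
    · have h3 : ∀ x, (successors s' a' h ++ [x]).take n = successors s' a' h ++ [x] := fun x =>
        List.take_of_length_le (by simp; omega)
      simp only [h3, List.take_of_length_le h2.le]
      exact (expect_visitPotential _ _ hL hf _ h2).le
    · simp only [List.take_append_of_le_length h2, expect_const, le_refl]
  · simp only [h1, if_false, List.append_nil, expect_const, le_refl]

theorem visitPotential_take_eq (p : ℝ) (y : S) (L n : ℕ) (f : ℕ → ℕ → ℝ) (l : List S)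
    (hn : n ≤ l.length) :
    visitPotential p y L n f (l.take n) =
      ∏ ℓ ∈ Finset.range L, ENNReal.ofReal (f ℓ (hits L ℓ y (l.take n))) := by
  simp [visitPotential, List.length_take, min_eq_left hn, binE]

theorem visitPotential_nil (p : ℝ) (y : S) (L n : ℕ) (f : ℕ → ℕ → ℝ) :
    visitPotential p y L n f [] =
      ∏ ℓ ∈ Finset.range L, ENNReal.ofReal (binE p (f ℓ) (slots L ℓ n) 0) := by
  simp [visitPotential, hits_nil, slots]

end Potential

/-! ### Probabilities of the bad events -/

section Events
variable {S : Type u} {A : Type v} [Fintype S] [DecidableEq S] [Fintype A] [Nonempty A]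
  [DecidableEq A]

/-- After n visits no draw is pending and the potential is the product of the `f ℓ`; at the start it
is the product of binomial expectations. Datasets thus behave as independent, even if n visits may
never occur. -/
theorem prob_hits_le (M : MDP S A) (I : Input S A) (K : ℕ) (s : S) (a : A) (y : S) {L : ℕ}
    (n : ℕ) (hL : 0 < L) {f : ℕ → ℕ → ℝ} (hf : ∀ ℓ m, 0 ≤ f ℓ m)
    (E : Set (List (List (S × A × S))))
    (hE : ∀ τs ∈ E, n ≤ (successors s a τs.flatten).length ∧
      ∀ ℓ < L, 1 ≤ f ℓ (hits L ℓ y ((successors s a τs.flatten).take n))) :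
    (law M I K).toOuterMeasure E ≤
      ∏ ℓ ∈ Finset.range L, ENNReal.ofReal (binE (M.P s a y).toReal (f ℓ) (slots L ℓ n) 0) := by
  rw [← visitPotential_nil (y := y)]
  refine (toOuterMeasure_le_expect _ _ (fun τs => visitPotential (M.P s a y).toReal y L n f
    ((successors s a τs.flatten).take n)) fun τs hτs => ?_).trans ?_
  · obtain ⟨h1, h2⟩ := hE τs hτs
    rw [visitPotential_take_eq _ _ _ _ _ _ h1]
    refine Finset.one_le_prod' fun ℓ hℓ => ?_
    rw [← ENNReal.ofReal_one]
    exact ENNReal.ofReal_le_ofReal (h2 ℓ (Finset.mem_range.1 hℓ))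
  · have := expect_law_flatten_le M I K (fun h => visitPotential (M.P s a y).toReal y L n f
      ((successors s a h).take n)) fun h s' a' => expect_visitPotential_take M s a y n hL hf h s' a'
    simpa [successors] using this

theorem prob_no_optimism_le (M : MDP S A) (I : Input S A) (K : ℕ) (s : S) (a : A) (y : S) {L : ℕ}
    (n : ℕ) (hL : 0 < L) :
    (law M I K).toOuterMeasure {τs | n ≤ (successors s a τs.flatten).length ∧
      ∀ ℓ < L, (M.P s a y).toReal * (slots L ℓ n + 2) <
        hits L ℓ y ((successors s a τs.flatten).take n)} ≤ ENNReal.ofReal ((11 / 12) ^ L) := by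
  have hp0 : 0 ≤ (M.P s a y).toReal := ENNReal.toReal_nonneg
  have hp1 : (M.P s a y).toReal ≤ 1 :=
    ENNReal.toReal_le_of_le_ofReal zero_le_one (by simpa using PMF.coe_le_one _ _)
  refine (prob_hits_le M I K s a y n hL (f := fun ℓ m =>
    if (M.P s a y).toReal * (slots L ℓ n + 2) < m then 1 else 0)
    (fun ℓ m => by positivity) _ fun τs hτs => ?_).trans ?_
  · exact ⟨hτs.1, fun ℓ hℓ => by rw [if_pos (hτs.2 ℓ hℓ)]⟩
  · calc _ ≤ ∏ _ℓ ∈ Finset.range L, ENNReal.ofReal (11 / 12) :=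
        Finset.prod_le_prod' fun ℓ _ => ENNReal.ofReal_le_ofReal (binE_optimism_le hp0 hp1 _)
      _ = _ := by rw [Finset.prod_const, Finset.card_range, ENNReal.ofReal_pow (by norm_num)]

theorem prob_deviation_le (M : MDP S A) (I : Input S A) (K : ℕ) (s : S) (a : A) (y : S) {L : ℕ}
    (n : ℕ) {ℓ : ℕ} (hℓ : ℓ < L) {ι : ℝ} (hι : 0 ≤ ι) :
    (law M I K).toOuterMeasure {τs | n ≤ (successors s a τs.flatten).length ∧
      4 * slots L ℓ n * ι < (hits L ℓ y ((successors s a τs.flatten).take n) -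
        (M.P s a y).toReal * slots L ℓ n) ^ 2} ≤ ENNReal.ofReal (2 * Real.exp (-ι)) := by
  have hp0 : 0 ≤ (M.P s a y).toReal := ENNReal.toReal_nonneg
  have hp1 : (M.P s a y).toReal ≤ 1 :=
    ENNReal.toReal_le_of_le_ofReal zero_le_one (by simpa using PMF.coe_le_one _ _)
  refine (prob_hits_le M I K s a y n (Nat.zero_lt_of_lt hℓ) (f := fun ℓ' => if ℓ' = ℓ then
    fun m => if 4 * slots L ℓ n * ι < (m - (M.P s a y).toReal * slots L ℓ n) ^ 2 then 1 else 0
    else fun _ => 1)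
    (fun ℓ' m => by split_ifs <;> positivity) _ fun τs hτs => ?_).trans ?_
  · refine ⟨hτs.1, fun ℓ' hℓ' => ?_⟩
    by_cases h : ℓ' = ℓ
    · subst h
      rw [if_pos rfl, if_pos hτs.2]
    · rw [if_neg h]
  · rw [Finset.prod_eq_single ℓ]
    · rw [if_pos rfl]
      exact ENNReal.ofReal_le_ofReal (binE_deviation_le hp0 hp1 _ hι)
    · intro ℓ' _ h
      rw [if_neg h, binE_const, ENNReal.ofReal_one]
    · intro h
      exact absurd (Finset.mem_range.2 hℓ) h

theorem prob_unsupported (M : MDP S A) (I : Input S A) (K : ℕ) :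
    (law M I K).toOuterMeasure {τs | ¬ ∀ x ∈ τs.flatten, M.P x.1 x.2.1 x.2.2 ≠ 0} = 0 := by
  classical
  refine le_antisymm ?_ zero_le
  refine (toOuterMeasure_le_expect _ _ (fun τs =>
    if ∀ x ∈ τs.flatten, M.P x.1 x.2.1 x.2.2 ≠ 0 then 0 else 1) fun τs hτs => ?_).trans ?_
  · rw [if_neg hτs]
  · refine (expect_law_flatten_le M I K (fun h =>
      if ∀ x ∈ h, M.P x.1 x.2.1 x.2.2 ≠ 0 then 0 else 1) fun h s a => ?_).trans (by simp)
    by_cases hh : ∀ x ∈ h, M.P x.1 x.2.1 x.2.2 ≠ 0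
    · rw [if_pos hh, expect_congr_support (g := fun _ => 0), expect_const]
      intro x hx
      refine if_pos fun z hz => ?_
      rcases List.mem_append.1 hz with hz | hz
      · exact hh z hz
      · rw [List.mem_singleton.1 hz]; exact hx
    · rw [if_neg hh]
      refine (expect_mono _ (g := fun _ => 1) fun x => ?_).trans_eq (expect_const _ _)
      split_ifs <;> simp

theorem prob_long_le (M : MDP S A) (I : Input S A) (K : ℕ) {T : ℝ} (hT : 0 < T) :
    (law M I K).toOuterMeasure {τs | T < τs.flatten.length} ≤
      ENNReal.ofReal (K * (1 / (1 - M.γ)) / T) := by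
  have hγ : 0 < 1 - M.γ := by linarith [M.γ_lt_one]
  refine (toOuterMeasure_le_expect _ _ (fun τs => ENNReal.ofReal (1 / T) * τs.flatten.length)
    fun τs hτs => ?_).trans_eq ?_
  · rw [← ENNReal.ofReal_natCast, ← ENNReal.ofReal_mul (by positivity), ← ENNReal.ofReal_one]
    refine ENNReal.ofReal_le_ofReal ?_
    have h : T < τs.flatten.length := hτs
    rw [one_div, inv_mul_eq_div, le_div_iff₀ hT]
    linarith
  · rw [expect_mul_left, expect_law_length, ← ENNReal.ofReal_natCast,
      ← ENNReal.ofReal_mul (by positivity), ← ENNReal.ofReal_mul (by positivity)]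
    congr 1
    ring

end Events

/-! ### Widths along the last pairs -/

section Occupancy
variable {S : Type u} {A : Type v} [DecidableEq S] [DecidableEq A]

/-- Number of trajectories that end with the pair `(s, a)`. -/
def lastCount (τs : List (List (S × A × S))) (s : S) (a : A) : ℕ :=
  τs.countP fun τ => MDP.lastPair τ = some (s, a)

/-- Confidence width, up to a factor, computed from the last pairs only. -/
noncomputable def width (τs : List (List (S × A × S))) (s : S) (a : A) : ℝ :=
  1 / Real.sqrt (lastCount τs s a + 1)

/-- The width at the last pair of a trajectory. -/
noncomputable def widthAt (τs : List (List (S × A × S))) (o : Option (S × A)) : ℝ :=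
  o.elim 0 fun x => width τs x.1 x.2

theorem width_mem_Icc (τs : List (List (S × A × S))) (s : S) (a : A) :
    width τs s a ∈ Set.Icc (0 : ℝ) 1 := by
  constructor
  · unfold width; positivity
  · rw [width, div_le_one (by positivity), Real.one_le_sqrt]
    have : (0 : ℝ) ≤ lastCount τs s a := by positivity
    linarith

theorem lastCount_concat (τs : List (List (S × A × S))) (τ : List (S × A × S)) (s : S) (a : A) :
    lastCount (τs ++ [τ]) s a =
      lastCount τs s a + if MDP.lastPair τ = some (s, a) then 1 else 0 := by
  simp [lastCount, List.countP_append, List.countP_singleton]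

theorem lastCount_le_length_successors (τs : List (List (S × A × S))) (s : S) (a : A) :
    lastCount τs s a ≤ (successors s a τs.flatten).length := by
  induction τs using List.reverseRecOn with
  | nil => simp [lastCount]
  | append_singleton τs τ ih =>
    have h1 : successors s a (τs ++ [τ]).flatten =
        successors s a τs.flatten ++ successors s a τ := by
      simp [successors, List.filterMap_append]
    rw [lastCount_concat, h1, List.length_append]
    refine add_le_add ih ?_
    split_ifs with h
    · simp only [MDP.lastPair, Option.map_eq_some_iff] at h
      obtain ⟨x, hx, hx2⟩ := h
      simp only [Prod.mk.injEq] at hx2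
      refine List.length_pos_of_mem (a := x.2.2) ?_
      simp only [successors, List.mem_filterMap]
      exact ⟨x, List.mem_of_getLast? hx, by simp [hx2]⟩
    · exact Nat.zero_le _

variable [Fintype S] [Fintype A]

theorem sum_lastCount_le (τs : List (List (S × A × S))) :
    ∑ s, ∑ a, lastCount τs s a ≤ τs.length := by
  induction τs using List.reverseRecOn with
  | nil => simp [lastCount]
  | append_singleton τs τ ih =>
    simp only [lastCount_concat, Finset.sum_add_distrib, List.length_append, List.length_singleton]
    refine add_le_add ih ?_
    rcases MDP.lastPair τ with - | ⟨s', a'⟩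
    · simp
    · rw [← Finset.sum_product']
      simp only [Option.some.injEq]
      rw [Finset.sum_ite_eq]
      split_ifs <;> simp

/-- Each new last pair pays 1/√(m+1) ≤ 2(√(m+1) - √m), an increment of the right-hand side. -/
theorem sum_widthAt_le_sqrt (τs : List (List (S × A × S))) :
    ∑ k ∈ Finset.range τs.length, widthAt (τs.take k) (τs[k]?.bind MDP.lastPair) ≤
      ∑ s, ∑ a, 2 * Real.sqrt (lastCount τs s a) := by
  induction τs using List.reverseRecOn with
  | nil => simp [lastCount]
  | append_singleton τs τ ih =>
    rw [List.length_append, List.length_singleton, Finset.sum_range_succ]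
    have h1 : ∀ k ∈ Finset.range τs.length, widthAt ((τs ++ [τ]).take k)
        ((τs ++ [τ])[k]?.bind MDP.lastPair) =
        widthAt (τs.take k) (τs[k]?.bind MDP.lastPair) := by
      intro k hk
      rw [Finset.mem_range] at hk
      rw [List.take_append_of_le_length hk.le, List.getElem?_append_left hk]
    have h2 : widthAt ((τs ++ [τ]).take τs.length)
        ((τs ++ [τ])[τs.length]?.bind MDP.lastPair) = widthAt τs (MDP.lastPair τ) := by
      simp
    rw [Finset.sum_congr rfl h1, h2]
    have h3 : widthAt τs (MDP.lastPair τ) ≤ ∑ s, ∑ a, (2 * Real.sqrt (lastCount (τs ++ [τ]) s a) -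
        2 * Real.sqrt (lastCount τs s a)) := by
      have h4 : ∀ s a, 2 * Real.sqrt (lastCount (τs ++ [τ]) s a) -
          2 * Real.sqrt (lastCount τs s a) ≥
          if MDP.lastPair τ = some (s, a) then width τs s a else 0 := by
        intro s a
        rw [lastCount_concat]
        split_ifs with h
        · push_cast
          set m : ℝ := (lastCount τs s a : ℝ)
          have hm : 0 ≤ m := by positivity
          rw [ge_iff_le, width, div_le_iff₀ (by positivity)]
          have e1 := Real.mul_self_sqrt (show 0 ≤ m + 1 by positivity)
          have e2 := Real.mul_self_sqrt hm
          nlinarith [sq_nonneg (Real.sqrt (m + 1) - Real.sqrt m)]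
        · simp
      refine le_trans ?_ (Finset.sum_le_sum fun s _ => Finset.sum_le_sum fun a _ => h4 s a)
      rcases MDP.lastPair τ with - | ⟨s', a'⟩
      · simp [widthAt]
      · rw [← Finset.sum_product']
        simp only [Option.some.injEq]
        rw [Finset.sum_ite_eq, if_pos (by simp)]
        simp [widthAt]
    simp only [Finset.sum_sub_distrib] at h3
    linarith

/-- Cauchy–Schwarz over the pairs, since the last-pair counts add up to at most the number of
trajectories. -/
theorem sum_widthAt_le (τs : List (List (S × A × S))) :
    ∑ k ∈ Finset.range τs.length, widthAt (τs.take k) (τs[k]?.bind MDP.lastPair) ≤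
      2 * Real.sqrt (Fintype.card S * Fintype.card A * τs.length) := by
  refine (sum_widthAt_le_sqrt τs).trans ?_
  have h1 : ∑ s, ∑ a, 2 * Real.sqrt (lastCount τs s a) =
      2 * ∑ x : S × A, Real.sqrt (lastCount τs x.1 x.2) := by
    rw [Fintype.sum_prod_type, Finset.mul_sum]
    simp only [Finset.mul_sum]
  rw [h1]
  refine mul_le_mul_of_nonneg_left (Real.le_sqrt_of_sq_le ?_) (by norm_num)
  refine (sq_sum_le_card_mul_sum_sq).trans ?_
  simp only [Real.sq_sqrt (Nat.cast_nonneg _), Finset.card_univ, Fintype.card_prod]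
  push_cast
  refine mul_le_mul_of_nonneg_left ?_ (by positivity)
  rw [Fintype.sum_prod_type]
  exact_mod_cast sum_lastCount_le τs

variable [Nonempty A]

/-- Logarithm of the supermartingale that compares widths under the occupancy measures with widths
at the sampled last pairs. -/
noncomputable def widthLog (M : MDP S A) (I : Input S A) (τs : List (List (S × A × S))) : ℝ :=
  ∑ k ∈ Finset.range τs.length,
    ((∑ s, ∑ a, M.occupancy (run M.γ I (τs.take k)).policy s a * width (τs.take k) s a) / 2 -
      widthAt (τs.take k) (τs[k]?.bind MDP.lastPair))

theorem widthLog_concat (M : MDP S A) (I : Input S A) (τs : List (List (S × A × S)))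
    (τ : List (S × A × S)) :
    widthLog M I (τs ++ [τ]) = widthLog M I τs +
      ((∑ s, ∑ a, M.occupancy (run M.γ I τs).policy s a * width τs s a) / 2 -
        widthAt τs (MDP.lastPair τ)) := by
  rw [widthLog, List.length_append, List.length_singleton, Finset.sum_range_succ]
  congr 1
  · refine Finset.sum_congr rfl fun k hk => ?_
    rw [Finset.mem_range] at hk
    rw [List.take_append_of_le_length hk.le, List.getElem?_append_left hk]
  · simp

/-- This inequality is the source of the factor 1/2 in `widthLog`. -/
theorem exp_neg_le_one_sub_half {x : ℝ} (h0 : 0 ≤ x) (h1 : x ≤ 1) :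
    Real.exp (-x) ≤ 1 - x / 2 := by
  have h4 : 1 + x + x ^ 2 / 2 ≤ Real.exp x := Real.quadratic_le_exp_of_nonneg h0
  rw [Real.exp_neg, inv_le_comm₀ (Real.exp_pos _) (by linarith)]
  refine le_trans ?_ h4
  rw [inv_le_iff_one_le_mul₀ (by linarith)]
  nlinarith [mul_nonneg h0 (sub_nonneg.2 h1), mul_nonneg (mul_nonneg h0 h0) (sub_nonneg.2 h1)]

/-- The widths depend only on earlier trajectories and the last pair is drawn from the occupancy
measure. With D the mean width, the conditional mean of exp(-width) is therefore at most 1 - D/2 ≤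
exp(-D/2). -/
theorem expect_exp_widthLog_le (M : MDP S A) (I : Input S A) (K : ℕ) :
    expect (law M I K) (fun τs => ENNReal.ofReal (Real.exp (widthLog M I τs))) ≤ 1 := by
  induction K with
  | zero => simp [law, expect_pure, widthLog]
  | succ K ih =>
    rw [expect_law_succ]
    refine (expect_mono _ fun τs => ?_).trans ih
    set π := (run M.γ I τs).policy with hπ
    set D := ∑ s, ∑ a, M.occupancy π s a * width τs s a with hD
    have h1 : ∀ τ, ENNReal.ofReal (Real.exp (widthLog M I (τs ++ [τ]))) =
        ENNReal.ofReal (Real.exp (widthLog M I τs + D / 2)) *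
          ENNReal.ofReal (Real.exp (-widthAt τs (MDP.lastPair τ))) := by
      intro τ
      rw [widthLog_concat, ← ENNReal.ofReal_mul (Real.exp_pos _).le, ← Real.exp_add]
      congr 2
      ring
    simp only [h1]
    rw [expect_mul_left, M.expect_trajectoryLaw_lastPair π
      (fun o => ENNReal.ofReal (Real.exp (-widthAt τs o)))]
    have h2 : ∑ s, ∑ a, ENNReal.ofReal (M.occupancy π s a) *
        ENNReal.ofReal (Real.exp (-widthAt τs (some (s, a)))) =
        ENNReal.ofReal (∑ s, ∑ a, M.occupancy π s a * Real.exp (-width τs s a)) := by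
      have hnn : ∀ s a, 0 ≤ M.occupancy π s a * Real.exp (-width τs s a) := fun s a =>
        mul_nonneg (M.occupancy_nonneg _ _ _) (Real.exp_pos _).le
      rw [ENNReal.ofReal_sum_of_nonneg fun s _ => Finset.sum_nonneg fun a _ => hnn s a]
      refine Finset.sum_congr rfl fun s _ => ?_
      rw [ENNReal.ofReal_sum_of_nonneg fun a _ => hnn s a]
      refine Finset.sum_congr rfl fun a _ => ?_
      rw [← ENNReal.ofReal_mul (M.occupancy_nonneg _ _ _)]
      rfl
    have h3 : ∑ s, ∑ a, M.occupancy π s a * Real.exp (-width τs s a) ≤ Real.exp (-(D / 2)) := by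
      calc _ ≤ ∑ s, ∑ a, M.occupancy π s a * (1 - width τs s a / 2) :=
            Finset.sum_le_sum fun s _ => Finset.sum_le_sum fun a _ =>
              mul_le_mul_of_nonneg_left (exp_neg_le_one_sub_half (width_mem_Icc τs s a).1
                (width_mem_Icc τs s a).2) (M.occupancy_nonneg _ _ _)
        _ = 1 - D / 2 := by
            have e1 := M.sum_occupancy_mul_state π (fun _ => 1)
            simp only [mul_one, M.sum_stateOcc] at e1
            conv_rhs => rw [← e1, hD]
            simp only [Finset.sum_div, ← Finset.sum_sub_distrib]
            exact Finset.sum_congr rfl fun s _ => Finset.sum_congr rfl fun a _ => by ring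
        _ ≤ _ := by
            have := Real.add_one_le_exp (-(D / 2))
            linarith
    rw [h2, ← ENNReal.ofReal_mul (Real.exp_pos _).le]
    refine ENNReal.ofReal_le_ofReal ?_
    refine (mul_le_mul_of_nonneg_left h3 (Real.exp_pos _).le).trans_eq ?_
    rw [← Real.exp_add]
    congr 1
    ring

theorem prob_widthLog_le (M : MDP S A) (I : Input S A) (K : ℕ) {δ : ℝ} (hδ : 0 < δ) :
    (law M I K).toOuterMeasure {τs | Real.log (1 / δ) < widthLog M I τs} ≤ ENNReal.ofReal δ := by
  refine (toOuterMeasure_le_expect _ _ (fun τs => ENNReal.ofReal δ *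
    ENNReal.ofReal (Real.exp (widthLog M I τs))) fun τs hτs => ?_).trans ?_
  · rw [← ENNReal.ofReal_mul hδ.le, ← ENNReal.ofReal_one]
    refine ENNReal.ofReal_le_ofReal ?_
    have h : Real.log (1 / δ) < widthLog M I τs := hτs
    have h2 := Real.exp_lt_exp.2 h
    rw [Real.exp_log (by positivity), div_lt_iff₀ hδ] at h2
    linarith
  · rw [expect_mul_left]
    exact mul_le_of_le_one_right zero_le (expect_exp_widthLog_le M I K)

end Occupancy

/-! ### The good event for the critics -/

section GoodEvent
variable {S : Type u} {A : Type v} [DecidableEq S] [DecidableEq A]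

/-- On this event every critic is accurate and some critic is optimistic, for each pair of states
and each number of visits. -/
structure CriticsGood (M : MDP S A) (L : ℕ) (ι : ℝ) (h : List (S × A × S)) : Prop where
  supported : ∀ x ∈ h, M.P x.1 x.2.1 x.2.2 ≠ 0
  optimistic : ∀ s a y n, n ≤ (successors s a h).length → ∃ ℓ < L,
    (hits L ℓ y ((successors s a h).take n) : ℝ) ≤ (M.P s a y).toReal * (slots L ℓ n + 2)
  accurate : ∀ s a y n, n ≤ (successors s a h).length → ∀ ℓ < L,
    ((hits L ℓ y ((successors s a h).take n) : ℝ) - (M.P s a y).toReal * slots L ℓ n) ^ 2 ≤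
      4 * slots L ℓ n * ι

/-- Quantifying over all visit numbers n makes the event pass to prefixes, so one event serves all
iterations. -/
theorem CriticsGood.of_append {M : MDP S A} {L : ℕ} {ι : ℝ} {h h' : List (S × A × S)}
    (hg : CriticsGood M L ι (h ++ h')) : CriticsGood M L ι h := by
  have h1 : ∀ s a, successors s a (h ++ h') = successors s a h ++ successors s a h' := by
    intro s a
    simp [successors, List.filterMap_append]
  have h2 : ∀ s a n, n ≤ (successors s a h).length →
      (successors s a (h ++ h')).take n = (successors s a h).take n := by
    intro s a n hn
    rw [h1, List.take_append_of_le_length hn]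
  have h3 : ∀ s a n, n ≤ (successors s a h).length → n ≤ (successors s a (h ++ h')).length := by
    intro s a n hn
    rw [h1, List.length_append]
    omega
  refine ⟨fun x hx => hg.supported x (List.mem_append_left _ hx), fun s a y n hn => ?_,
    fun s a y n hn ℓ hℓ => ?_⟩
  · rw [← h2 s a n hn]
    exact hg.optimistic s a y n (h3 s a n hn)
  · rw [← h2 s a n hn]
    exact hg.accurate s a y n (h3 s a n hn) ℓ hℓ

variable [Fintype S]

/-- V may depend on the data: its ordering of the two successors only selects y, and the event holds
for every y. -/
theorem CriticsGood.aggregate_le {M : MDP S A} (hM : M.IsBinarized) {L : ℕ} {ι : ℝ}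
    {h : List (S × A × S)} (hg : CriticsGood M L ι h) (rule : Rule) {V : S → ℝ} {b : ℝ}
    (hb : 0 ≤ b) (hV : ∀ s, V s ∈ Set.Icc 0 b) (s : S) (a : A) :
    aggregate rule (fun ℓ : Fin L => critic ((recordAll L h).2 ℓ) V s a) ≤ M.next V s a := by
  obtain ⟨y, z, hyz, hsupp⟩ := exists_ordered_support hM V s a
  obtain ⟨ℓ, hℓ, hle⟩ := hg.optimistic s a y _ le_rfl
  rw [List.take_length] at hle
  refine (Soar.aggregate_le rule (fun ℓ => (critic_mem_Icc _ hb hV L h ℓ rfl s a).1)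
    ⟨ℓ, hℓ⟩).trans ?_
  exact critic_le_next L h ℓ V (fun s => (hV s).1) s a hyz hsupp hg.supported hle

theorem CriticsGood.le_aggregate {M : MDP S A} (hM : M.IsBinarized) {L : ℕ} (hL : 0 < L) {ι : ℝ}
    {h : List (S × A × S)} (hg : CriticsGood M L ι h) (rule : Rule) {V : S → ℝ} {b : ℝ}
    (hb : 0 ≤ b) (hV : ∀ s, V s ∈ Set.Icc 0 b) (s : S) (a : A) :
    M.next V s a - aggregate rule (fun ℓ : Fin L => critic ((recordAll L h).2 ℓ) V s a) ≤
      b * (3 * L * (4 + 2 * Real.sqrt ι) * Real.sqrt L) *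
        (1 / Real.sqrt ((successors s a h).length + 1)) := by
  obtain ⟨y, z, hyz, hsupp⟩ := exists_ordered_support hM V s a
  set n := (successors s a h).length with hn
  have h1 : ∀ ℓ : Fin L, |critic ((recordAll L h).2 ℓ) V s a - M.next V s a| ≤
      b * (4 + 2 * Real.sqrt ι) * Real.sqrt L * (1 / Real.sqrt (n + 1)) := by
    intro ℓ
    have h2 := hg.accurate s a y _ le_rfl ℓ ℓ.2
    rw [List.take_length] at h2
    refine (abs_critic_sub_next_le L h ℓ hV s a hyz hsupp hg.supported h2).trans ?_
    rw [mul_assoc (b * _), div_eq_mul_inv]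
    refine mul_le_mul_of_nonneg_left ?_ (by positivity)
    have h3 : ((n : ℝ) + 1) ≤ L * (slots L ℓ n + 1) := by
      exact_mod_cast length_le_mul_slots ℓ.2 n
    have h4 := Real.sqrt_le_sqrt h3
    rw [Real.sqrt_mul (by positivity)] at h4
    rw [mul_one_div, inv_eq_one_div, div_le_div_iff₀ (by positivity) (by positivity), one_mul]
    exact h4
  have h2 := Soar.le_aggregate rule hL h1
  linarith

end GoodEvent

/-! ### Regret on the good event, and its probability -/

section Regret
variable {S : Type u} {A : Type v} [Fintype S] [DecidableEq S] [Fintype A] [Nonempty A]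
  [DecidableEq A]

theorem policyRegret_le_of_good {M : MDP S A} (hM : M.IsBinarized) (I : Input S A) (hL : 0 < I.L)
    (hc : ∀ s a, I.c₀ s a ∈ Set.Icc (0 : ℝ) 1)
    (hV : ∀ s, I.V₁ s ∈ Set.Icc (0 : ℝ) (1 / (1 - M.γ))) (hη : 0 < I.η) {ι e : ℝ}
    (τs : List (List (S × A × S))) (hgood : CriticsGood M I.L ι τs.flatten)
    (hlog : widthLog M I τs ≤ e) (πstar : Policy S A) :
    policyRegret M I τs.length πstar τs ≤
      Real.log (Fintype.card A) / (I.η * (1 - M.γ)) + I.η * τs.length / (1 - M.γ) ^ 4 +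
      (2 + 3 * I.L * (4 + 2 * Real.sqrt ι) * Real.sqrt I.L *
        (4 * Real.sqrt (Fintype.card S * Fintype.card A * τs.length) + 2 * e)) /
        (1 - M.γ) ^ 2 := by
  have hγ0 := M.γ_nonneg
  have hγ1 := M.γ_lt_one
  have hγ : 0 < 1 - M.γ := by linarith
  set B := 1 / (1 - M.γ) with hB
  have hB0 : 0 < B := by positivity
  set W := 3 * I.L * (4 + 2 * Real.sqrt ι) * Real.sqrt I.L with hW
  have hW0 : 0 ≤ W := by positivity
  set K := τs.length with hK
  -- The default `[]` is never reached, since k < K.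
  have htake : ∀ k < K, τs.take (k + 1) = τs.take k ++ [τs.getD k []] := by
    intro k hk
    simp [hK ▸ hk]
  have hVb : ∀ k s, (run M.γ I (τs.take k)).V s ∈ Set.Icc 0 B := fun k s =>
    run_V_mem_Icc hγ0 hγ1 I hL hc hV _ s
  have hgoodk : ∀ k, CriticsGood M I.L ι (τs.take k).flatten := by
    intro k
    have h1 : τs.flatten = (τs.take k).flatten ++ (τs.drop k).flatten := by
      rw [← List.flatten_append, List.take_append_drop]
    rw [h1] at hgood
    exact hgood.of_append
  have hQ : ∀ k < K, ∀ s a, runQ M.γ I (τs.take k) (τs.getD k []) s a =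
      (run M.γ I (τs.take (k + 1))).c s a + M.γ * aggregate I.rule (fun ℓ : Fin I.L =>
        critic ((recordAll I.L (τs.take (k + 1)).flatten).2 ℓ) (run M.γ I (τs.take k)).V s a) := by
    intro k hk s a
    rw [runQ, ← htake k hk, run_R]
    rfl
  have hreg := M.optimistic_regret hη K (fun k => (run M.γ I (τs.take k)).policy)
    (fun k => (run M.γ I (τs.take k)).V) (fun k => (run M.γ I (τs.take (k + 1))).c)
    (fun k => runQ M.γ I (τs.take k) (τs.getD k []))
    (fun s => by simp [run, initState])
    (fun k hk s => by simp only [htake k hk, run_policy_concat])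
    (fun k hk s => by simp only [htake k hk, run_V_concat])
    (fun k _ s => hVb k s)
    (fun k _ s a => runQ_mem_Icc hγ0 hγ1 I hL hc _ (hVb k) _ s a)
    (fun k hk s a => by
      rw [hQ k hk]
      have := (hgoodk (k + 1)).aggregate_le hM I.rule hB0.le (hVb k) s a
      have := mul_le_mul_of_nonneg_left this hγ0
      linarith)
    πstar
  have hbonus : ∑ k ∈ Finset.range K, ∑ s, ∑ a,
      M.occupancy (run M.γ I (τs.take k)).policy s a * ((run M.γ I (τs.take (k + 1))).c s a +
        M.γ * M.next (run M.γ I (τs.take k)).V s a -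
        runQ M.γ I (τs.take k) (τs.getD k []) s a) ≤
      B * W * ∑ k ∈ Finset.range K, ∑ s, ∑ a,
        M.occupancy (run M.γ I (τs.take k)).policy s a * width (τs.take k) s a := by
    simp only [Finset.mul_sum]
    refine Finset.sum_le_sum fun k hk => Finset.sum_le_sum fun s _ => Finset.sum_le_sum fun a _ => ?_
    rw [Finset.mem_range] at hk
    rw [hQ k hk, mul_left_comm]
    refine mul_le_mul_of_nonneg_left ?_ (M.occupancy_nonneg _ _ _)
    have h1 := (hgoodk (k + 1)).le_aggregate hM hL I.rule hB0.le (hVb k) s a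
    rw [← hW] at h1
    -- The critics of an iteration already contain its own trajectory, while the width uses only
    -- earlier ones; passing to fewer visits enlarges the bound and makes the width predictable.
    have h2 : (1 : ℝ) / Real.sqrt ((successors s a (τs.take (k + 1)).flatten).length + 1) ≤
        width (τs.take k) s a := by
      refine one_div_le_one_div_of_le (by positivity) (Real.sqrt_le_sqrt ?_)
      have h3 := lastCount_le_length_successors (τs.take (k + 1)) s a
      rw [htake k hk, lastCount_concat, ← htake k hk] at h3
      have h4 : lastCount (τs.take k) s a ≤
        (successors s a (τs.take (k + 1)).flatten).length := (Nat.le_add_right _ _).trans h3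
      exact_mod_cast Nat.succ_le_succ h4
    have h3 := mul_le_mul_of_nonneg_left h2 (show 0 ≤ B * W by positivity)
    have h4 := h1.trans h3
    have h5 : 0 ≤ B * W * width (τs.take k) s a :=
      mul_nonneg (by positivity) (width_mem_Icc _ s a).1
    have h6 := mul_le_mul_of_nonneg_left h4 hγ0
    have h7 := mul_le_mul_of_nonneg_right hγ1.le h5
    linarith
  have hwidth : ∑ k ∈ Finset.range K, ∑ s, ∑ a,
        M.occupancy (run M.γ I (τs.take k)).policy s a * width (τs.take k) s a ≤
      4 * Real.sqrt (Fintype.card S * Fintype.card A * K) + 2 * e := by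
    have h1 := sum_widthAt_le τs
    rw [widthLog, Finset.sum_sub_distrib, ← Finset.sum_div] at hlog
    linarith
  have h1 := hbonus.trans (mul_le_mul_of_nonneg_left hwidth (show 0 ≤ B * W by positivity))
  have h2 : policyRegret M I K πstar τs ≤ B * (B * W * (4 * Real.sqrt
      (Fintype.card S * Fintype.card A * K) + 2 * e) + 2 * B +
      Real.log (Fintype.card A) / I.η + I.η * K * B ^ 3) := by
    rw [policyRegret, ← one_div]
    exact mul_le_mul_of_nonneg_left (hreg.trans (by linarith)) hB0.le
  refine h2.trans_eq ?_
  rw [hB]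
  field_simp
  ring

theorem policyRegret_le_trivial (M : MDP S A) (I : Input S A)
    (hc : ∀ s a, I.c₀ s a ∈ Set.Icc (0 : ℝ) 1) (K : ℕ) (πstar : Policy S A)
    (τs : List (List (S × A × S))) : policyRegret M I K πstar τs ≤ K / (1 - M.γ) := by
  have hγ : 0 < 1 - M.γ := by linarith [M.γ_lt_one]
  rw [policyRegret, div_eq_inv_mul]
  refine mul_le_mul_of_nonneg_left ?_ (by positivity)
  calc _ ≤ ∑ _k ∈ Finset.range K, (1 : ℝ) := by
        refine Finset.sum_le_sum fun k _ => ?_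
        refine le_trans (Finset.sum_le_sum fun s _ => Finset.sum_le_sum fun a _ => ?_)
          (M.sum_occupancy_mul_le (run M.γ I (τs.take k)).policy
            (fun s a => (run_c_mem_Icc M.γ I hc (τs.take (k + 1)) s a).2))
        have h1 := run_c_mem_Icc M.γ I hc (τs.take (k + 1)) s a
        have h2 := mul_nonneg h1.1 (M.occupancy_nonneg πstar s a)
        linarith
    _ = K := by simp

theorem prob_not_criticsGood_le (M : MDP S A) (I : Input S A) (K : ℕ) {L T : ℕ} (hL : 0 < L)
    {ι : ℝ} (hι : 0 ≤ ι) :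
    (law M I K).toOuterMeasure
      {τs | ¬ CriticsGood M L ι τs.flatten ∧ τs.flatten.length ≤ T} ≤
      ENNReal.ofReal (Fintype.card S * Fintype.card A * Fintype.card S * (T + 1) *
        ((11 / 12) ^ L + L * (2 * Real.exp (-ι)))) := by
  set E₁ : S → A → S → ℕ → Set (List (List (S × A × S))) := fun s a y n =>
    {τs | n ≤ (successors s a τs.flatten).length ∧
      ∀ ℓ < L, (M.P s a y).toReal * (slots L ℓ n + 2) <
        hits L ℓ y ((successors s a τs.flatten).take n)} with hE₁
  set E₂ : S → A → S → ℕ → ℕ → Set (List (List (S × A × S))) := fun s a y n ℓ =>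
    {τs | n ≤ (successors s a τs.flatten).length ∧
      4 * slots L ℓ n * ι < (hits L ℓ y ((successors s a τs.flatten).take n) -
        (M.P s a y).toReal * slots L ℓ n) ^ 2} with hE₂
  set E₀ : Set (List (List (S × A × S))) :=
    {τs | ¬ ∀ x ∈ τs.flatten, M.P x.1 x.2.1 x.2.2 ≠ 0} with hE₀
  have hsub : {τs | ¬ CriticsGood M L ι τs.flatten ∧ τs.flatten.length ≤ T} ⊆
      E₀ ∪ ⋃ s, ⋃ a, ⋃ y, ⋃ n ∈ Finset.range (T + 1),
        (E₁ s a y n ∪ ⋃ ℓ ∈ Finset.range L, E₂ s a y n ℓ) := by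
    rintro τs ⟨h1, h2⟩
    by_contra h3
    simp only [Set.mem_union, Set.mem_iUnion, not_or, not_exists, Finset.mem_range] at h3
    obtain ⟨h3, h4⟩ := h3
    have hlen : ∀ s a, (successors s a τs.flatten).length ≤ τs.flatten.length := fun s a =>
      List.length_filterMap_le _ _
    refine h1 ⟨?_, fun s a y n hn => ?_, fun s a y n hn ℓ hℓ => ?_⟩
    · simpa [hE₀] using h3
    · have h5 := (h4 s a y n (by have := hlen s a; omega)).1
      by_contra! h6
      exact h5 ⟨hn, h6⟩
    · have h5 := (h4 s a y n (by have := hlen s a; omega)).2 ℓ hℓ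
      by_contra! h6
      exact h5 ⟨hn, h6⟩
  set x : ℝ := (11 / 12) ^ L + L * (2 * Real.exp (-ι)) with hx
  have hx0 : 0 ≤ x := by positivity
  have hone : ∀ s a y n, (law M I K).toOuterMeasure
      (E₁ s a y n ∪ ⋃ ℓ ∈ Finset.range L, E₂ s a y n ℓ) ≤ ENNReal.ofReal x := by
    intro s a y n
    rw [hx, ENNReal.ofReal_add (by positivity) (by positivity),
      ENNReal.ofReal_mul (p := (L : ℝ)) (by positivity)]
    refine (MeasureTheory.measure_union_le _ _).trans
      (add_le_add (prob_no_optimism_le M I K s a y n hL) ?_)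
    refine (MeasureTheory.measure_biUnion_finset_le _ _).trans ?_
    refine (Finset.sum_le_sum fun ℓ hℓ =>
      prob_deviation_le M I K s a y n (Finset.mem_range.1 hℓ) hι).trans_eq ?_
    simp
  refine (MeasureTheory.measure_mono hsub).trans ((MeasureTheory.measure_union_le _ _).trans ?_)
  rw [hE₀, prob_unsupported, zero_add]
  calc _ ≤ ∑ _s : S, ∑ _a : A, ∑ _y : S, ∑ _n ∈ Finset.range (T + 1), ENNReal.ofReal x := by
        refine (MeasureTheory.measure_iUnion_fintype_le _ _).trans (Finset.sum_le_sum fun s _ => ?_)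
        refine (MeasureTheory.measure_iUnion_fintype_le _ _).trans (Finset.sum_le_sum fun a _ => ?_)
        refine (MeasureTheory.measure_iUnion_fintype_le _ _).trans (Finset.sum_le_sum fun y _ => ?_)
        refine (MeasureTheory.measure_biUnion_finset_le _ _).trans (Finset.sum_le_sum fun n _ => ?_)
        exact hone s a y n
    _ = _ := by
        have h1 : (Fintype.card S : ℝ) * Fintype.card A * Fintype.card S * (T + 1) * x =
            ((Fintype.card S * (Fintype.card A * (Fintype.card S * (T + 1))) : ℕ) : ℝ) * x := by
          push_cast; ring
        rw [h1, ENNReal.ofReal_mul (Nat.cast_nonneg _), ENNReal.ofReal_natCast]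
        simp only [Finset.sum_const, Finset.card_univ, Finset.card_range, nsmul_eq_mul]
        push_cast
        ring

end Regret

/-! ### Arithmetic of the constants -/

section Arithmetic

/-- As 36 = 3·12, (11/12)^L ≤ exp(-L/12) ≤ X⁻³. The choice ι = 9 log X makes the deviation terms at
most X⁻³/3, and the number of events is at most (4/3)X²δ, leaving (16/9)δ/X with X ≥ 3. -/
theorem union_bound_le {s a K δ X : ℝ} {L : ℕ} (hs : 1 ≤ s) (ha : 1 ≤ a) (hK : 1 ≤ K) (hδ : 0 < δ)
    (hδ3 : δ < 1 / 3) (hX : X = s * a * K / δ) (hL : L = ⌈36 * Real.log X⌉₊) :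
    s * a * s * (⌊K ^ 2 / δ⌋₊ + 1) *
      ((11 / 12) ^ L + L * (2 * Real.exp (-(9 * Real.log X)))) ≤ δ := by
  have hX0 : 0 < X := by rw [hX]; positivity
  have hsaK : 1 ≤ s * a * K := by
    have := one_le_mul_of_one_le_of_one_le hs ha
    exact one_le_mul_of_one_le_of_one_le this hK
  have hX3 : 3 ≤ X := by
    rw [hX, le_div_iff₀ hδ]; linarith
  have hlog : 0 ≤ Real.log X := Real.log_nonneg (by linarith)
  have hXexp : Real.exp (Real.log X) = X := Real.exp_log hX0
  have h1 : (11 / 12 : ℝ) ^ L ≤ 1 / X ^ 3 := by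
    have e1 : (11 / 12 : ℝ) ≤ Real.exp (-(1 / 12)) := by
      have := Real.add_one_le_exp (-(1 / 12 : ℝ))
      linarith
    calc (11 / 12 : ℝ) ^ L ≤ Real.exp (-(1 / 12)) ^ L := pow_le_pow_left₀ (by norm_num) e1 _
      _ = Real.exp (L * (-(1 / 12))) := (Real.exp_nat_mul _ _).symm
      _ ≤ Real.exp (-((3 : ℕ) * Real.log X)) := by
          rw [Real.exp_le_exp, hL]
          have := Nat.le_ceil (36 * Real.log X)
          push_cast
          linarith
      _ = 1 / X ^ 3 := by rw [Real.exp_neg, Real.exp_nat_mul, hXexp, one_div]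
  have h2 : (L : ℝ) ≤ 36 * X := by
    have e1 := Nat.ceil_lt_add_one (show 0 ≤ 36 * Real.log X by positivity)
    have e2 := Real.log_le_sub_one_of_pos hX0
    rw [← hL] at e1
    linarith
  have h3 : Real.exp (-(9 * Real.log X)) = 1 / X ^ 9 := by
    rw [show 9 * Real.log X = (9 : ℕ) * Real.log X by norm_num, Real.exp_neg, Real.exp_nat_mul,
      hXexp, one_div]
  have h4 : (L : ℝ) * (2 * Real.exp (-(9 * Real.log X))) ≤ 1 / 3 * (1 / X ^ 3) := by
    rw [h3]
    have e1 : (3 : ℝ) ^ 5 ≤ X ^ 5 := pow_le_pow_left₀ (by norm_num) hX3 5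
    calc (L : ℝ) * (2 * (1 / X ^ 9)) ≤ 36 * X * (2 * (1 / X ^ 9)) :=
          mul_le_mul_of_nonneg_right h2 (by positivity)
      _ = 72 / X ^ 5 * (1 / X ^ 3) := by field_simp; norm_num
      _ ≤ 1 / 3 * (1 / X ^ 3) := by
          refine mul_le_mul_of_nonneg_right ?_ (by positivity)
          rw [div_le_iff₀ (by positivity)]
          linarith
  have h5 : ((⌊K ^ 2 / δ⌋₊ : ℝ) + 1) ≤ 4 / 3 * (K ^ 2 / δ) := by
    have e1 := Nat.floor_le (show 0 ≤ K ^ 2 / δ by positivity)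
    have e2 : 3 ≤ K ^ 2 / δ := by
      rw [le_div_iff₀ hδ]; nlinarith
    linarith
  have h6 : s * a * s * (4 / 3 * (K ^ 2 / δ)) ≤ 4 / 3 * (X ^ 2 * δ) := by
    have e1 : X ^ 2 * δ = s * a * s * (K ^ 2 / δ) * a := by
      rw [hX]; field_simp
    rw [e1]
    have e2 : s * a * s * (K ^ 2 / δ) * 1 ≤ s * a * s * (K ^ 2 / δ) * a :=
      mul_le_mul_of_nonneg_left ha (by positivity)
    linarith
  calc _ ≤ 4 / 3 * (X ^ 2 * δ) * (4 / 3 * (1 / X ^ 3)) := by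
        refine mul_le_mul ((mul_le_mul_of_nonneg_left h5 (by positivity)).trans h6) (by linarith)
          (by positivity) (by positivity)
    _ = 16 / 9 / X * δ := by field_simp; norm_num
    _ ≤ 1 * δ := by
        refine mul_le_mul_of_nonneg_right ?_ hδ.le
        rw [div_le_one hX0]; linarith
    _ = δ := one_mul δ

theorem one_le_log_one_div {δ : ℝ} (hδ : 0 < δ) (hδ3 : δ < 1 / 3) : 1 ≤ Real.log (1 / δ) := by
  rw [Real.le_log_iff_exp_le (by positivity), le_div_iff₀ hδ]
  have := Real.exp_one_lt_d9
  nlinarith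

/-- L, ι and hence the critic factor are polynomial in F: 3·36F·10√F·6√F = 6480F². The additive
log(1/δ) is absorbed as √l·√l ≤ F·R. -/
theorem bonus_le {s a K δ X F : ℝ} {L : ℕ} (hs : 1 ≤ s) (ha : 1 ≤ a) (hK : 1 ≤ K) (hδ : 0 < δ)
    (hδ3 : δ < 1 / 3) (hX : X = s * a * K / δ) (hL : L = ⌈36 * Real.log X⌉₊)
    (hF : 1 + Real.log X ≤ F) :
    2 + 3 * L * (4 + 2 * Real.sqrt (9 * Real.log X)) * Real.sqrt L *
        (4 * Real.sqrt (s * a * K) + 2 * Real.log (1 / δ)) ≤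
      40000 * F ^ 3 * Real.sqrt (K * s ^ 2 * a * Real.log (1 / δ)) := by
  have hsaK : 1 ≤ s * a * K :=
    one_le_mul_of_one_le_of_one_le (one_le_mul_of_one_le_of_one_le hs ha) hK
  have hl1 := one_le_log_one_div hδ hδ3
  set l := Real.log (1 / δ) with hl
  have hlX : l ≤ Real.log X := by
    refine Real.log_le_log (by positivity) ?_
    rw [hX]
    gcongr
  have hlog : 0 ≤ Real.log X := by linarith
  have hF1 : 1 ≤ F := by linarith
  have hLF : (L : ℝ) ≤ 36 * F := by
    have e1 := Nat.ceil_lt_add_one (show 0 ≤ 36 * Real.log X by positivity)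
    rw [← hL] at e1
    linarith
  set f := Real.sqrt F with hf
  have hf2 : f ^ 2 = F := Real.sq_sqrt (by linarith)
  have hf1 : 1 ≤ f := Real.one_le_sqrt.2 hF1
  have hsL : Real.sqrt L ≤ 6 * f := by
    rw [Real.sqrt_le_left (by positivity), mul_pow, hf2]
    linarith
  have hsι : Real.sqrt (9 * Real.log X) ≤ 3 * f := by
    rw [Real.sqrt_le_left (by positivity), mul_pow, hf2]
    linarith
  set R := Real.sqrt (K * s ^ 2 * a * l) with hR
  have hR2 : Real.sqrt (s * a * K) ≤ R := by
    refine Real.sqrt_le_sqrt ?_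
    have e1 : 1 ≤ s * l := one_le_mul_of_one_le_of_one_le hs hl1
    have e2 := le_mul_of_one_le_right (show 0 ≤ s * a * K by positivity) e1
    linarith
  have hR1 : 1 ≤ R := (Real.one_le_sqrt.2 hsaK).trans hR2
  have hlR : l ≤ F * R := by
    have e1 : Real.sqrt l ≤ R := by
      refine Real.sqrt_le_sqrt ?_
      have e1 : 1 ≤ s * (s * a * K) := one_le_mul_of_one_le_of_one_le hs hsaK
      have e2 := le_mul_of_one_le_right (show 0 ≤ l by positivity) e1
      linarith
    have e2 : Real.sqrt l ≤ F := by
      rw [Real.sqrt_le_left (by linarith)]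
      nlinarith
    calc l = Real.sqrt l * Real.sqrt l := (Real.mul_self_sqrt (by linarith)).symm
      _ ≤ F * R := mul_le_mul e2 e1 (Real.sqrt_nonneg _) (by linarith)
  have hW : 3 * L * (4 + 2 * Real.sqrt (9 * Real.log X)) * Real.sqrt L ≤ 6480 * F ^ 2 := by
    calc _ ≤ 3 * (36 * F) * (4 * f + 2 * (3 * f)) * (6 * f) := by
          gcongr
          linarith
      _ = 6480 * F * f ^ 2 := by ring
      _ = 6480 * F ^ 2 := by rw [hf2]; ring
  have hFR : 1 ≤ F * R := one_le_mul_of_one_le_of_one_le hF1 hR1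
  have hRF : R ≤ F * R := le_mul_of_one_le_left (by linarith) hF1
  have hF2 : 1 ≤ F ^ 2 := one_le_pow₀ hF1
  calc _ ≤ 2 + 6480 * F ^ 2 * (4 * (F * R) + 2 * (F * R)) := by
        gcongr
        exact hR2.trans hRF
    _ ≤ 2 * (F ^ 2 * (F * R)) + 6480 * F ^ 2 * (4 * (F * R) + 2 * (F * R)) := by
        have := one_le_mul_of_one_le_of_one_le hF2 hFR
        linarith
    _ = 38882 * F ^ 3 * R := by ring
    _ ≤ 40000 * F ^ 3 * R := by
        gcongr
        norm_num

end Arithmetic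

theorem one_add_log_le_logFactor {S : Type u} {A : Type v} [Fintype S] [Fintype A] [Nonempty S] [Nonempty A] {K : ℕ} (hK : 1 ≤ K) {γ δ : ℝ} (hγ0 : 0 ≤ γ)
    (hγ1 : γ < 1) (hδ : 0 < δ) :
    1 + Real.log (Fintype.card S * Fintype.card A * K / δ) ≤ logFactor S A K γ δ := by
  have h1 : (0 : ℝ) < Fintype.card S := by exact_mod_cast Fintype.card_pos
  have h2 : (0 : ℝ) < Fintype.card A := by exact_mod_cast Fintype.card_pos
  have h3 : (0 : ℝ) < K := by exact_mod_cast hK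
  have h4 : 0 < 1 - γ := by linarith
  refine add_le_add_right (Real.log_le_log (by positivity) ?_) _
  refine div_le_div_of_nonneg_left (by positivity) (by positivity) ?_
  exact mul_le_of_le_one_left hδ.le (by linarith)

/-! ### High-probability bound and tuning of the step size -/

variable {S : Type u} {A : Type v} [Fintype S] [DecidableEq S] [Fintype A] [Nonempty A]
  [DecidableEq A]

/-- The regret bound for a positive step size. -/
theorem policyRegret_bound {M : MDP S A} (hM : M.IsBinarized) {K : ℕ} (hK : 1 ≤ K) {δ : ℝ}
    (hδ : 0 < δ) (hδ3 : δ < 1 / 3) (I : Input S A) (hIL : I.L = numCritics S A K δ)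
    (hc : ∀ s a, I.c₀ s a ∈ Set.Icc (0 : ℝ) 1)
    (hV : ∀ s, I.V₁ s ∈ Set.Icc (0 : ℝ) (1 / (1 - M.γ))) (hη : 0 < I.η) :
    ENNReal.ofReal (1 - 3 * δ) ≤ (law M I K).toOuterMeasure
      {τs | ∀ πstar : Policy S A, policyRegret M I K πstar τs ≤
        Real.log (Fintype.card A) / (I.η * (1 - M.γ)) + I.η * K / (1 - M.γ) ^ 4 +
          40000 * logFactor S A K M.γ δ ^ 3 * (Real.sqrt (K * (Fintype.card S : ℝ) ^ 2 *
            Fintype.card A * Real.log (1 / δ)) / (1 - M.γ) ^ 2)} := by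
  have hγ0 := M.γ_nonneg
  have hγ1 := M.γ_lt_one
  have hγ : 0 < 1 - M.γ := by linarith
  obtain ⟨s₀, -⟩ := M.ν₀.support_nonempty
  have : Nonempty S := ⟨s₀⟩
  have hs1 : (1 : ℝ) ≤ Fintype.card S := by exact_mod_cast Fintype.card_pos
  have ha1 : (1 : ℝ) ≤ Fintype.card A := by exact_mod_cast Fintype.card_pos
  have hK1 : (1 : ℝ) ≤ K := by exact_mod_cast hK
  set X : ℝ := Fintype.card S * Fintype.card A * K / δ with hX
  have hF := one_add_log_le_logFactor (S := S) (A := A) hK hγ0 hγ1 hδ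
  have hl1 := one_le_log_one_div hδ hδ3
  have hsaK : (1 : ℝ) ≤ Fintype.card S * Fintype.card A * K :=
    one_le_mul_of_one_le_of_one_le (one_le_mul_of_one_le_of_one_le hs1 ha1) hK1
  have hlX : Real.log (1 / δ) ≤ Real.log X := Real.log_le_log (by positivity) (by rw [hX]; gcongr)
  have hF1 : 1 ≤ logFactor S A K M.γ δ := by linarith
  have hbonus := bonus_le hs1 ha1 hK1 hδ hδ3 hX hIL hF
  have hηn : 0 ≤ Real.log (Fintype.card A) / (I.η * (1 - M.γ)) + I.η * K / (1 - M.γ) ^ 4 := by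
    have := Real.log_nonneg ha1
    positivity
  set R := Real.sqrt (K * (Fintype.card S : ℝ) ^ 2 * Fintype.card A * Real.log (1 / δ)) with hR
  rcases le_or_gt (Real.sqrt K) (1 / (1 - M.γ)) with hBK | hBK
  · -- a long horizon makes the bound trivial
    have hall : {τs | ∀ πstar : Policy S A, policyRegret M I K πstar τs ≤
        Real.log (Fintype.card A) / (I.η * (1 - M.γ)) + I.η * K / (1 - M.γ) ^ 4 +
          40000 * logFactor S A K M.γ δ ^ 3 * (R / (1 - M.γ) ^ 2)} = Set.univ := by
      refine Set.eq_univ_of_forall fun τs πstar => ?_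
      refine (policyRegret_le_trivial M I hc K πstar τs).trans ?_
      have hKR : Real.sqrt K ≤ R := by
        refine Real.sqrt_le_sqrt ?_
        have e1 : 1 ≤ (Fintype.card S : ℝ) ^ 2 * Fintype.card A * Real.log (1 / δ) :=
          one_le_mul_of_one_le_of_one_le
            (one_le_mul_of_one_le_of_one_le (one_le_pow₀ hs1) ha1) hl1
        have e2 := le_mul_of_one_le_right (show (0 : ℝ) ≤ K by positivity) e1
        linarith
      have e1 : (K : ℝ) / (1 - M.γ) ≤ R / (1 - M.γ) ^ 2 := by
        calc (K : ℝ) / (1 - M.γ) = Real.sqrt K * Real.sqrt K * (1 / (1 - M.γ)) := by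
              rw [Real.mul_self_sqrt (by positivity)]; ring
          _ ≤ R * (1 / (1 - M.γ)) * (1 / (1 - M.γ)) := by gcongr
          _ = R / (1 - M.γ) ^ 2 := by field_simp
      have e2 : R / (1 - M.γ) ^ 2 ≤
          40000 * logFactor S A K M.γ δ ^ 3 * (R / (1 - M.γ) ^ 2) := by
        refine le_mul_of_one_le_left (by positivity) ?_
        have := one_le_pow₀ hF1 (n := 3)
        linarith
      linarith
    rw [hall, (PMF.toOuterMeasure_apply_eq_one_iff _ _).2 (Set.subset_univ _),
      ← ENNReal.ofReal_one]
    exact ENNReal.ofReal_le_ofReal (by linarith)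
  · have hL : 0 < I.L := by
      rw [hIL, numCritics, Nat.ceil_pos]
      have : 0 < Real.log X := by linarith
      positivity
    -- Here 1/(1-γ) < √K ≤ K, so the mean total length is at most K² and exceeding K²/δ has
    -- probability at most δ.
    set T : ℕ := ⌊(K : ℝ) ^ 2 / δ⌋₊ with hT
    have hT0 : 0 < (K : ℝ) ^ 2 / δ := by positivity
    refine le_toOuterMeasure_of_compl _ _ (by positivity) ?_
    -- The intersection with the support supplies that the list consists of exactly K trajectories.
    have hsub : {τs | ∀ πstar : Policy S A, policyRegret M I K πstar τs ≤
        Real.log (Fintype.card A) / (I.η * (1 - M.γ)) + I.η * K / (1 - M.γ) ^ 4 +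
          40000 * logFactor S A K M.γ δ ^ 3 * (R / (1 - M.γ) ^ 2)}ᶜ ∩ (law M I K).support ⊆
        ({τs | ¬ CriticsGood M I.L (9 * Real.log X) τs.flatten ∧ τs.flatten.length ≤ T} ∪
          {τs | (K : ℝ) ^ 2 / δ < τs.flatten.length}) ∪
          {τs | Real.log (1 / δ) < widthLog M I τs} := by
      rintro τs ⟨h1, h2⟩
      by_contra h3
      simp only [Set.mem_union, Set.mem_ofPred_eq, not_or, not_and, not_lt] at h3
      obtain ⟨⟨h3, h4⟩, h5⟩ := h3
      have hgood : CriticsGood M I.L (9 * Real.log X) τs.flatten := by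
        by_contra h6
        exact h3 h6 ((Nat.le_floor_iff hT0.le).2 h4)
      refine h1 fun πstar => ?_
      have hlen := law_length M I K τs h2
      have h6 := policyRegret_le_of_good hM I hL hc hV hη τs hgood h5 πstar
      rw [hlen] at h6
      refine h6.trans (add_le_add_right ?_ _)
      rw [← mul_div_assoc]
      exact div_le_div_of_nonneg_right hbonus (by positivity)
    refine (PMF.toOuterMeasure_mono _ hsub).trans ?_
    have hE : ENNReal.ofReal (3 * δ) =
        ENNReal.ofReal δ + ENNReal.ofReal δ + ENNReal.ofReal δ := by
      rw [← ENNReal.ofReal_add hδ.le hδ.le, ← ENNReal.ofReal_add (by positivity) hδ.le]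
      congr 1
      ring
    rw [hE]
    refine (MeasureTheory.measure_union_le _ _).trans (add_le_add
      ((MeasureTheory.measure_union_le _ _).trans (add_le_add ?_ ?_)) (prob_widthLog_le M I K hδ))
    · refine (prob_not_criticsGood_le M I K hL (by linarith)).trans (ENNReal.ofReal_le_ofReal ?_)
      exact union_bound_le hs1 ha1 hK1 hδ hδ3 hX hIL
    · refine (prob_long_le M I K hT0).trans (ENNReal.ofReal_le_ofReal ?_)
      have hKs : Real.sqrt K ≤ K := by
        rw [Real.sqrt_le_left (by positivity)]
        nlinarith
      rw [div_le_iff₀ hT0]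
      calc (K : ℝ) * (1 / (1 - M.γ)) ≤ K * K := by gcongr; linarith
        _ = δ * (K ^ 2 / δ) := by field_simp

theorem policyRegret_eq_zero_of_card_eq_one (M : MDP S A) (I : Input S A) (K : ℕ)
    (h : Fintype.card A = 1) (πstar : Policy S A) (τs : List (List (S × A × S))) :
    policyRegret M I K πstar τs = 0 := by
  have hsub : Subsingleton A := (Fintype.card_le_one_iff_subsingleton).1 h.le
  have h1 : ∀ (p : PMF A) (a : A), p a = 1 := fun p a => by
    rw [← p.tsum_coe, tsum_fintype, Fintype.sum_subsingleton _ a]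
  have h2 : ∀ π : Policy S A, π = πstar := fun π => funext fun s => PMF.ext fun a => by rw [h1, h1]
  simp [policyRegret, h2]

/-- The step size balances the two terms, which become equal. -/
theorem step_size_bounds {a K g : ℝ} (ha : 0 < a) (hK : 0 < K) (hg : 0 < g) :
    a / (Real.sqrt (a * g ^ 3 / K) * g) + Real.sqrt (a * g ^ 3 / K) * K / g ^ 4 =
      2 * Real.sqrt (a * K / g ^ 5) := by
  set η := Real.sqrt (a * g ^ 3 / K) with hη
  have hη0 : 0 < η := Real.sqrt_pos.2 (by positivity)
  have hη2 : η ^ 2 = a * g ^ 3 / K := Real.sq_sqrt (by positivity)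
  have h1 : Real.sqrt (a * K / g ^ 5) = η * K / g ^ 4 := by
    rw [Real.sqrt_eq_iff_mul_self_eq (by positivity) (by positivity)]
    have : η * K / g ^ 4 * (η * K / g ^ 4) = η ^ 2 * K ^ 2 / g ^ 8 := by ring
    rw [this, hη2]
    field_simp
  have h2 : a / (η * g) = η * K / g ^ 4 := by
    rw [div_eq_div_iff (by positivity) (by positivity)]
    have : η * K * (η * g) = η ^ 2 * K * g := by ring
    rw [this, hη2]
    field_simp
  rw [h1, h2]
  ring

end Soar

theorem theorem2 :
    ∃ (C : ℝ) (p : ℕ), 0 < C ∧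
      ∀ (S : Type u) (A : Type v) [Fintype S] [DecidableEq S]
        [Fintype A] [Nonempty A] [DecidableEq A]
        (M : Soar.MDP S A) (_ : M.IsBinarized)
        (K : ℕ) (_ : 1 ≤ K) (δ : ℝ) (_ : 0 < δ) (_ : δ < 1)
        (I : Soar.Input S A) (_ : I.L = Soar.numCritics S A K δ)
        (_ : ∀ s a, I.c₀ s a ∈ Set.Icc (0 : ℝ) 1)
        (_ : ∀ s, I.V₁ s ∈ Set.Icc (0 : ℝ) (1 / (1 - M.γ))),
        (0 < I.η →
          ENNReal.ofReal (1 - 3 * δ) ≤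
            (Soar.law M I K).toOuterMeasure
              {τs | ∀ πstar : Soar.Policy S A,
                Soar.policyRegret M I K πstar τs ≤
                  Real.log (Fintype.card A) / (I.η * (1 - M.γ))
                  + I.η * K / (1 - M.γ) ^ 4
                  + C * Soar.logFactor S A K M.γ δ ^ p *
                    (Real.sqrt (K * (Fintype.card S : ℝ) ^ 2 * Fintype.card A *
                      Real.log (1 / δ)) / (1 - M.γ) ^ 2)}) ∧
        (I.η = Real.sqrt (Real.log (Fintype.card A) * (1 - M.γ) ^ 3 / K) →
          ENNReal.ofReal (1 - 3 * δ) ≤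
            (Soar.law M I K).toOuterMeasure
              {τs | ∀ πstar : Soar.Policy S A,
                Soar.policyRegret M I K πstar τs ≤
                  C * Soar.logFactor S A K M.γ δ ^ p *
                    Real.sqrt (K * (Fintype.card S : ℝ) ^ 2 * Fintype.card A *
                      Real.log (1 / δ) / (1 - M.γ) ^ 5)}) := by
  -- 40000 comes from the bonus, and 2 from the two balanced step-size terms.
  refine ⟨40002, 3, by norm_num, ?_⟩
  intro S A _ _ _ _ _ M hM K hK δ hδ hδ1 I hIL hc hV
  -- For δ ≥ 1/3 the claimed probability is nonpositive.
  rcases le_or_gt (1 / 3) δ with hδ3 | hδ3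
  · have h0 : ENNReal.ofReal (1 - 3 * δ) = 0 := ENNReal.ofReal_of_nonpos (by linarith)
    rw [h0]
    exact ⟨fun _ => zero_le, fun _ => zero_le⟩
  have hγ0 := M.γ_nonneg
  have hγ1 := M.γ_lt_one
  have hγ : 0 < 1 - M.γ := by linarith
  obtain ⟨s₀, -⟩ := M.ν₀.support_nonempty
  have : Nonempty S := ⟨s₀⟩
  have hs1 : (1 : ℝ) ≤ Fintype.card S := by exact_mod_cast Fintype.card_pos
  have ha1 : (1 : ℝ) ≤ Fintype.card A := by exact_mod_cast Fintype.card_pos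
  have hK1 : (1 : ℝ) ≤ K := by exact_mod_cast hK
  have hl1 := Soar.one_le_log_one_div hδ hδ3
  have hF1 : 1 ≤ Soar.logFactor S A K M.γ δ := by
    refine le_trans ?_ (Soar.one_add_log_le_logFactor hK hγ0 hγ1 hδ)
    refine le_add_of_nonneg_right (Real.log_nonneg ?_)
    rw [le_div_iff₀ hδ]
    have := one_le_mul_of_one_le_of_one_le (one_le_mul_of_one_le_of_one_le hs1 ha1) hK1
    linarith
  have hF3 := one_le_pow₀ hF1 (n := 3)
  constructor
  · intro hη
    refine (Soar.policyRegret_bound hM hK hδ hδ3 I hIL hc hV hη).trans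
      (MeasureTheory.measure_mono fun τs hτs πstar => (hτs πstar).trans ?_)
    gcongr
    norm_num
  · intro hη
    -- With a single action the prescribed step size is 0, outside the general bound, but there is
    -- only one policy and the regret vanishes.
    rcases eq_or_ne (Fintype.card A) 1 with hA | hA
    · have hall : {τs | ∀ πstar : Soar.Policy S A, Soar.policyRegret M I K πstar τs ≤
          40002 * Soar.logFactor S A K M.γ δ ^ 3 * Real.sqrt (K * (Fintype.card S : ℝ) ^ 2 *
            Fintype.card A * Real.log (1 / δ) / (1 - M.γ) ^ 5)} = Set.univ := by
        refine Set.eq_univ_of_forall fun τs πstar => ?_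
        rw [Soar.policyRegret_eq_zero_of_card_eq_one M I K hA]
        positivity
      rw [hall, (PMF.toOuterMeasure_apply_eq_one_iff _ _).2 (Set.subset_univ _),
        ← ENNReal.ofReal_one]
      exact ENNReal.ofReal_le_ofReal (by linarith)
    · have ha2 : (1 : ℝ) < Fintype.card A := by
        have : 0 < Fintype.card A := Fintype.card_pos
        exact_mod_cast (show 1 < Fintype.card A by omega)
      have hla : 0 < Real.log (Fintype.card A) := Real.log_pos ha2
      have hη0 : 0 < I.η := by
        rw [hη]
        exact Real.sqrt_pos.2 (by positivity)
      refine (Soar.policyRegret_bound hM hK hδ hδ3 I hIL hc hV hη0).trans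
        (MeasureTheory.measure_mono fun τs hτs πstar => (hτs πstar).trans ?_)
      rw [hη, Soar.step_size_bounds hla (by linarith) hγ]
      set Y := (K : ℝ) * (Fintype.card S : ℝ) ^ 2 * Fintype.card A * Real.log (1 / δ) with hY
      have hY0 : 0 ≤ Y := by positivity
      have h1 : Real.sqrt (Real.log (Fintype.card A) * K / (1 - M.γ) ^ 5) ≤
          Real.sqrt (Y / (1 - M.γ) ^ 5) := by
        refine Real.sqrt_le_sqrt (div_le_div_of_nonneg_right ?_ (by positivity))
        have e1 : Real.log (Fintype.card A) ≤ Fintype.card A :=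
          (Real.log_le_sub_one_of_pos (by linarith)).trans (by linarith)
        have e2 : 1 ≤ (Fintype.card S : ℝ) ^ 2 * Real.log (1 / δ) :=
          one_le_mul_of_one_le_of_one_le (one_le_pow₀ hs1) hl1
        calc Real.log (Fintype.card A) * K ≤ Fintype.card A * K := by gcongr
          _ ≤ Fintype.card A * K * ((Fintype.card S : ℝ) ^ 2 * Real.log (1 / δ)) :=
              le_mul_of_one_le_right (by positivity) e2
          _ = Y := by rw [hY]; ring
      -- One factor √(1-γ) is given away here: (1-γ)⁵ ≤ (1-γ)⁴.
      have h2 : Real.sqrt Y / (1 - M.γ) ^ 2 ≤ Real.sqrt (Y / (1 - M.γ) ^ 5) := by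
        refine Real.le_sqrt_of_sq_le ?_
        rw [div_pow, Real.sq_sqrt hY0]
        refine div_le_div_of_nonneg_left hY0 (by positivity) ?_
        rw [← pow_mul]
        exact pow_le_pow_of_le_one hγ.le (by linarith) (by norm_num)
      set Z := Real.sqrt (Y / (1 - M.γ) ^ 5) with hZ
      have hZ0 : 0 ≤ Z := Real.sqrt_nonneg _
      have h3 := mul_le_mul_of_nonneg_left h2
        (show 0 ≤ 40000 * Soar.logFactor S A K M.γ δ ^ 3 by positivity)
      have h4 := mul_le_mul_of_nonneg_right hF3 hZ0
      linarith
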